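/- Let $\Omega\subset\mathbb R^3$ be a bounded, open, connected polyhedral domain (its closure is a finite union of tetrahedra and $\Omega$ is the interior of its closure). Let $\Gamma=\partial\Omega$ have the connected components $\Gamma_0,\Gamma_1,\dots,\Gamma_L$ ($L\ge 0$), where $\Gamma_0$ is the exterior one, i.e. the one that contains the boundary of the unbounded component of $\mathbb R^3\setminus\overline\Omega$. Let $\boldsymbol n$ be the outward unit normal on $\Gamma$, let $\boldsymbol n_i$ be its restriction to $\Gamma_i$, and let $(\cdot,\cdot)$ denote the $L^2(\Omega)$ pairing. Let $\varepsilon=(\varepsilon_{ij})_{3\times3}$ have entries in $L^\infty(\Omega)$ and be symmetric and uniformly positive definite a.e. in $\Omega$. Let $f\in L^1(\Omega)$ be such that $f\varphi\in L^1(\Omega)$ for every $\varphi\in H^1(\Omega)$ (for instance $f\in L^2(\Omega)$), let $\boldsymbol g\in[L^2(\Omega)]^3$, and let $\phi_1\in H^{-1/2}(\Gamma)$, the dual of the trace space $H^{1/2}(\Gamma)\cong H^1(\Omega)/H^1_0(\Omega)$. Put $$H^1_{0c}(\Omega)=\{\phi\in H^1(\Omega):\ \phi|_{\Gamma_0}=0,\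 \phi|_{\Gamma_i}\text{ is constant for each } i=1,\dots,L\},$$ $$H_0(\mathrm{curl};\Omega)=\{\boldsymbol v\in[L^2(\Omega)]^3:\ \nabla\times\boldsymbol v\in[L^2(\Omega)]^3,\ \boldsymbol v\times\boldsymbol n=0\text{ on }\Gamma\},$$ where boundary values are understood in the sense of traces; for a field $\boldsymbol v\in[L^2(\Omega)]^3$ with distributional divergence $d$, the normal trace is defined by $\langle\boldsymbol v\cdot\boldsymbol n,\varphi\rangle=(\boldsymbol v,\nabla\varphi)+(d,\varphi)$ for $\varphi\in H^1(\Omega)$, and $\langle \boldsymbol v\cdot\boldsymbol n_i,1\rangle_{\Gamma_i}$ is its value at a $\varphi$ with $\varphi|_{\Gamma_i}=1$ and $\varphi|_{\Gamma_j}=0$ for $j\neq i$. Assume the compatibility condition $\nabla\cdot\boldsymbol g=0$ in $\Omega$ and $\langle\boldsymbol g\cdot\boldsymbol n_i,1\rangle_{\Gamma_i}=0$ for $i=1,\dots,L$. Let $(\boldsymbol u,s)\in[L^2(\Omega)]^3\times H^1_{0c}(\Omega)$ be any solution of the extended weak formulation $$(\boldsymbol u,\ \varepsilon\nabla\varphi+\nabla\times\boldsymbol\psi)+(\boldsymbol\psi,\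 \varepsilon\nabla s)=(\boldsymbol g,\boldsymbol\psi)-(f,\varphi)+\langle\phi_1,\varphi\rangle\qquad\forall\varphi\in H^1(\Omega),\ \forall\boldsymbol\psi\in H_0(\mathrm{curl};\Omega).$$ Then $$\nabla\cdot(\varepsilon\boldsymbol u)=f\ \text{ in }\Omega,\qquad \nabla\times\boldsymbol u=\boldsymbol g\ \text{ in }\Omega,\qquad s=0\ \text{ in }\Omega,\qquad \varepsilon\boldsymbol u\cdot\boldsymbol n=\phi_1\ \text{ on }\Gamma,$$ where the first two equations hold in the sense of distributions and the last one in $H^{-1/2}(\Gamma)$. -/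

import Mathlib

open MeasureTheory Filter Topology TopologicalSpace
open scoped ENNReal ContDiff Distributions

noncomputable section

namespace DivCurl

/-- Three-dimensional Euclidean space. -/
abbrev E3 : Type := EuclideanSpace ℝ (Fin 3)

/-! ### Polyhedral domains and the components of their boundary -/

/-- A polyhedral open set: it has no slits, and its closure is a finite union of (closed,
nondegenerate) tetrahedra. -/
def IsPolyhedral (Ω : Set E3) : Prop :=
  interior (closure Ω) = Ω ∧
    ∃ T : Set (Affine.Simplex ℝ E3 3), T.Finite ∧ closure Ω = ⋃ t ∈ T, t.closedInterior

/-- The union of the unbounded connected components of the complement of `closure Ω`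
(for a bounded `Ω` there is exactly one such component). -/
def exteriorRegion (Ω : Set E3) : Set E3 :=
  {x | x ∈ (closure Ω)ᶜ ∧ ¬ Bornology.IsBounded (connectedComponentIn (closure Ω)ᶜ x)}

/-- `Γ 0, …, Γ L` are the connected components of `∂Ω`, and `Γ 0` is the exterior one: it contains
the boundary of the exterior region. (Finitely many disjoint closed connected nonempty sets that
cover `∂Ω` are exactly its connected components.) -/
structure IsBoundaryDecomposition (Ω : Set E3) (L : ℕ) (Γ : Fin (L + 1) → Set E3) : Prop where
  isClosed : ∀ i, IsClosed (Γ i)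
  isConnected : ∀ i, IsConnected (Γ i)
  disjoint : ∀ i j, i ≠ j → Disjoint (Γ i) (Γ j)
  iUnion_eq : ⋃ i, Γ i = frontier Ω
  exterior : frontier (exteriorRegion Ω) ⊆ Γ 0

/-! ### `L²` and `H¹` -/

/-- `L²(Ω)`. -/
abbrev L2 (Ω : Opens E3) : Type := Lp ℝ 2 (volume.restrict (Ω : Set E3))

/-- `[L²(Ω)]³`. -/
abbrev L2Vec (Ω : Opens E3) : Type := Lp E3 2 (volume.restrict (Ω : Set E3))

theorem integrable_smul_of_memLp {Ω : Opens E3} {a : E3 → ℝ} {b : E3 → E3}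
    (ha : MemLp a 2 (volume.restrict (Ω : Set E3)))
    (hb : MemLp b 2 (volume.restrict (Ω : Set E3))) :
    Integrable (fun x => a x • b x) (volume.restrict (Ω : Set E3)) :=
  memLp_one_iff_integrable.1 (hb.smul ha)

theorem memLp_test {Ω : Opens E3} (η : 𝓓(Ω, ℝ)) :
    MemLp η 2 (volume.restrict (Ω : Set E3)) :=
  (η.continuous.memLp_of_hasCompactSupport η.hasCompactSupport).restrict _

theorem memLp_gradient_test {Ω : Opens E3} (η : 𝓓(Ω, ℝ)) :
    MemLp (gradient η) 2 (volume.restrict (Ω : Set E3)) := by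
  have hc : Continuous (fderiv ℝ η) := η.contDiff.continuous_fderiv (by simp)
  have hg : Continuous (gradient η) :=
    (InnerProductSpace.toDual ℝ E3).symm.continuous.comp hc
  have hs : HasCompactSupport (gradient η) :=
    (η.hasCompactSupport.fderiv ℝ).comp_left
      (g := fun l => (InnerProductSpace.toDual ℝ E3).symm l) (map_zero _)
  exact (hg.memLp_of_hasCompactSupport hs).restrict _

/-- The Sobolev space `H¹(Ω)`, as the Hilbert space of pairs `(φ, ∇φ)` with `φ ∈ L²(Ω)` and weak
gradient `∇φ ∈ [L²(Ω)]³`; the norm is `(‖φ‖² + ‖∇φ‖²)^(1/2)`. -/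
def H1 (Ω : Opens E3) : Submodule ℝ (WithLp 2 (L2 Ω × L2Vec Ω)) where
  carrier := {p | ∀ η : 𝓓(Ω, ℝ),
    ∫ x in (Ω : Set E3), p.fst x • gradient η x = - ∫ x in (Ω : Set E3), η x • p.snd x}
  zero_mem' := by
    intro η
    have h1 : ∫ x in (Ω : Set E3), (0 : L2 Ω) x • gradient η x = 0 := by
      rw [integral_congr_ae (g := fun _ => (0 : E3)), integral_zero]
      filter_upwards [Lp.coeFn_zero ℝ 2 (volume.restrict (Ω : Set E3))] with x hx
      rw [hx, Pi.zero_apply, zero_smul]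
    have h2 : ∫ x in (Ω : Set E3), η x • (0 : L2Vec Ω) x = 0 := by
      rw [integral_congr_ae (g := fun _ => (0 : E3)), integral_zero]
      filter_upwards [Lp.coeFn_zero E3 2 (volume.restrict (Ω : Set E3))] with x hx
      rw [hx, Pi.zero_apply, smul_zero]
    exact h1.trans (by rw [← neg_zero, ← h2]; rfl)
  add_mem' := by
    intro p q hp hq η
    have h1 : ∫ x in (Ω : Set E3), (p.fst + q.fst) x • gradient η x
        = (∫ x in (Ω : Set E3), p.fst x • gradient η x)
          + ∫ x in (Ω : Set E3), q.fst x • gradient η x := by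
      rw [← integral_add (integrable_smul_of_memLp (Lp.memLp _) (memLp_gradient_test η))
        (integrable_smul_of_memLp (Lp.memLp _) (memLp_gradient_test η))]
      apply integral_congr_ae
      filter_upwards [Lp.coeFn_add p.fst q.fst] with x hx
      rw [hx, Pi.add_apply, add_smul]
    have h2 : ∫ x in (Ω : Set E3), η x • (p.snd + q.snd) x
        = (∫ x in (Ω : Set E3), η x • p.snd x) + ∫ x in (Ω : Set E3), η x • q.snd x := by
      rw [← integral_add (integrable_smul_of_memLp (memLp_test η) (Lp.memLp _))
        (integrable_smul_of_memLp (memLp_test η) (Lp.memLp _))]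
      apply integral_congr_ae
      filter_upwards [Lp.coeFn_add p.snd q.snd] with x hx
      rw [hx, Pi.add_apply, smul_add]
    change ∫ x in (Ω : Set E3), (p.fst + q.fst) x • gradient η x
      = - ∫ x in (Ω : Set E3), η x • (p.snd + q.snd) x
    rw [h1, h2, hp η, hq η, neg_add]
  smul_mem' := by
    intro c p hp η
    have h1 : ∫ x in (Ω : Set E3), (c • p.fst) x • gradient η x
        = c • ∫ x in (Ω : Set E3), p.fst x • gradient η x := by
      rw [← integral_smul]
      apply integral_congr_ae
      filter_upwards [Lp.coeFn_smul c p.fst] with x hx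
      rw [hx, Pi.smul_apply, smul_assoc]
    have h2 : ∫ x in (Ω : Set E3), η x • (c • p.snd) x
        = c • ∫ x in (Ω : Set E3), η x • p.snd x := by
      rw [← integral_smul]
      apply integral_congr_ae
      filter_upwards [Lp.coeFn_smul c p.snd] with x hx
      rw [hx, Pi.smul_apply, smul_comm]
    change ∫ x in (Ω : Set E3), (c • p.fst) x • gradient η x
      = - ∫ x in (Ω : Set E3), η x • (c • p.snd) x
    rw [h1, h2, hp η, smul_neg]

/-- The underlying function of an element of `H¹(Ω)`. -/
def toL2 {Ω : Opens E3} (φ : H1 Ω) : L2 Ω := (φ : WithLp 2 (L2 Ω × L2Vec Ω)).fst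

/-- The weak gradient of an element of `H¹(Ω)`. -/
def grad {Ω : Opens E3} (φ : H1 Ω) : L2Vec Ω := (φ : WithLp 2 (L2 Ω × L2Vec Ω)).snd

/-! ### Boundary values -/

/-- The elements of `H¹(Ω)` that come from `C_c^∞(Ω)`. -/
def testH1 (Ω : Opens E3) : Submodule ℝ (H1 Ω) where
  carrier := {v | ∃ η : 𝓓(Ω, ℝ), toL2 v =ᵐ[volume.restrict (Ω : Set E3)] η}
  zero_mem' := ⟨0, Lp.coeFn_zero ℝ 2 (volume.restrict (Ω : Set E3))⟩
  add_mem' := by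
    rintro v w ⟨η, hη⟩ ⟨θ, hθ⟩
    refine ⟨η + θ, ?_⟩
    filter_upwards [hη, hθ, Lp.coeFn_add (toL2 v) (toL2 w)] with x h1 h2 h3
    exact h3.trans (by rw [Pi.add_apply, h1, h2]; rfl)
  smul_mem' := by
    rintro c v ⟨η, hη⟩
    refine ⟨c • η, ?_⟩
    filter_upwards [hη, Lp.coeFn_smul c (toL2 v)] with x h1 h2
    exact h2.trans (by rw [Pi.smul_apply, h1]; rfl)

/-- `H¹₀(Ω)`, the closure of `C_c^∞(Ω)` in `H¹(Ω)`, i.e. the kernel of the trace map. -/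
def H10 (Ω : Opens E3) : Submodule ℝ (H1 Ω) := (testH1 Ω).topologicalClosure

/-- The trace space `H^{1/2}(∂Ω)`, with its quotient norm. -/
abbrev TraceSpace (Ω : Opens E3) : Type := H1 Ω ⧸ H10 Ω

/-- The trace map `H¹(Ω) → H^{1/2}(∂Ω)`. -/
def trace (Ω : Opens E3) : H1 Ω →ₗ[ℝ] TraceSpace Ω := (H10 Ω).mkQ

/-- `H^{-1/2}(∂Ω)`, the dual of `H^{1/2}(∂Ω)`. -/
abbrev DualTraceSpace (Ω : Opens E3) : Type := TraceSpace Ω →L[ℝ] ℝ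

/-- The elements of `H¹(Ω)` that are smooth in `Ω` and attain the boundary value `α` on `S ⊆ ∂Ω`
in the classical sense. -/
def classicalBoundaryValue (Ω : Opens E3) (S : Set E3) (α : ℝ) : Set (H1 Ω) :=
  {v | ∃ w : E3 → ℝ, ContDiffOn ℝ ∞ w Ω ∧ toL2 v =ᵐ[volume.restrict (Ω : Set E3)] w ∧
    ∀ y ∈ S, Tendsto w (𝓝[(Ω : Set E3)] y) (𝓝 α)}

/-- `φ = α` on the closed part `S` of `∂Ω`, in the sense of traces: `φ` is a limit in `H¹(Ω)` of
functions that attain the boundary value `α` on `S` classically. -/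
def HasBoundaryValue {Ω : Opens E3} (φ : H1 Ω) (S : Set E3) (α : ℝ) : Prop :=
  φ ∈ closure (classicalBoundaryValue Ω S α)

/-- `H¹_{0c}(Ω)`: functions with value `0` on `Γ 0` and constant on each `Γ i`, `i = 1, …, L`. -/
def MemH10c {Ω : Opens E3} {L : ℕ} (Γ : Fin (L + 1) → Set E3) (φ : H1 Ω) : Prop :=
  HasBoundaryValue φ (Γ 0) 0 ∧ ∀ i : Fin L, ∃ α : ℝ, HasBoundaryValue φ (Γ i.succ) α

/-! ### Divergence and curl -/

/-- `∇·v = d` in `Ω`, in the sense of distributions. -/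
def HasWeakDiv (Ω : Opens E3) (v : E3 → E3) (d : E3 → ℝ) : Prop :=
  ∀ η : 𝓓(Ω, ℝ),
    ∫ x in (Ω : Set E3), inner ℝ (v x) (gradient η x) = - ∫ x in (Ω : Set E3), d x * η x

/-- The curl of a field `w` whose components have the gradients `J i = ∇wᵢ`. -/
def curlOfGradients (J : Fin 3 → E3) : E3 :=
  !₂[J 2 1 - J 1 2, J 0 2 - J 2 0, J 1 0 - J 0 1]

/-- The classical curl. -/
def curl (w : E3 → E3) (x : E3) : E3 := curlOfGradients fun i => gradient (fun y => w y i) x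

/-- `∇×v = c` in `Ω`, in the sense of distributions. -/
def HasWeakCurl (Ω : Opens E3) (v c : E3 → E3) : Prop :=
  ∀ w : 𝓓(Ω, E3),
    ∫ x in (Ω : Set E3), inner ℝ (v x) (curl w x) = ∫ x in (Ω : Set E3), inner ℝ (c x) (w x)

/-- `v ∈ H₀(curl;Ω)` with `∇×v = c`. The tangential trace `v × n ∈ [H^{-1/2}(∂Ω)]³` is defined by
Green's formula, `⟨v × n, w⟩ = (v, ∇×w) - (∇×v, w)` for `w ∈ [H¹(Ω)]³`, and it has to vanish. -/
def MemH0Curl {Ω : Opens E3} (v c : L2Vec Ω) : Prop :=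
  HasWeakCurl Ω v c ∧ ∀ w : Fin 3 → H1 Ω,
    ∫ x in (Ω : Set E3), inner ℝ (v x) (curlOfGradients fun i => grad (w i) x)
      = ∫ x in (Ω : Set E3), inner ℝ (c x) (WithLp.toLp 2 fun i => toL2 (w i) x)

/-- The value at (the trace of) `φ ∈ H¹(Ω)` of the normal trace `v·n` of a field `v` with
`∇·v = d`, by Green's formula: `⟨v·n, φ⟩ = (v, ∇φ) + (d, φ)`. -/
def normalTrace {Ω : Opens E3} (v : E3 → E3) (d : E3 → ℝ) (φ : H1 Ω) : ℝ :=
  (∫ x in (Ω : Set E3), inner ℝ (v x) (grad φ x)) + ∫ x in (Ω : Set E3), d x * toL2 φ x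

/-- `⟨v·n, 1⟩_{Γ i} = c` for a field `v` with `∇·v = d`: the normal trace takes the value `c` at the
indicator function of `Γ i`, i.e. at an `H¹(Ω)` function with trace `1` on `Γ i` and `0` on the
other components (the value does not depend on the choice of that function). -/
def HasFlux (Ω : Opens E3) {L : ℕ} (Γ : Fin (L + 1) → Set E3) (v : E3 → E3) (d : E3 → ℝ)
    (i : Fin (L + 1)) (c : ℝ) : Prop :=
  ∃ χ : H1 Ω, HasBoundaryValue χ (Γ i) 1 ∧ (∀ j, j ≠ i → HasBoundaryValue χ (Γ j) 0) ∧
    normalTrace v d χ = c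

/-! ### The extended weak formulation -/

/-- A coefficient matrix: bounded measurable entries, symmetric, uniformly positive definite. -/
structure IsCoefficient (Ω : Opens E3) (ε : E3 → Matrix (Fin 3) (Fin 3) ℝ) : Prop where
  memLp_top : ∀ i j, MemLp (fun x => ε x i j) ∞ (volume.restrict (Ω : Set E3))
  isSymm : ∀ᵐ x ∂volume.restrict (Ω : Set E3), (ε x).IsSymm
  uniformlyPosDef : ∃ c : ℝ, 0 < c ∧ ∀ᵐ x ∂volume.restrict (Ω : Set E3), ∀ ξ : E3,
    c * ‖ξ‖ ^ 2 ≤ inner ℝ ξ (Matrix.toEuclideanLin (ε x) ξ)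

/-- The bilinear form `B(u,s;φ,ψ) = (u, ε∇φ + ∇×ψ) + (ψ, ε∇s)`; here `curlψ = ∇×ψ`. -/
def bilinearForm {Ω : Opens E3} (ε : E3 → Matrix (Fin 3) (Fin 3) ℝ) (u : L2Vec Ω) (s φ : H1 Ω)
    (ψ curlψ : L2Vec Ω) : ℝ :=
  (∫ x in (Ω : Set E3), inner ℝ (u x) (Matrix.toEuclideanLin (ε x) (grad φ x) + curlψ x))
    + ∫ x in (Ω : Set E3), inner ℝ (ψ x) (Matrix.toEuclideanLin (ε x) (grad s x))

/-- The linear form `F(φ,ψ) = (g,ψ) - (f,φ) + ⟨φ₁,φ⟩`. -/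
def linearForm {Ω : Opens E3} (f : E3 → ℝ) (g : L2Vec Ω) (φ₁ : DualTraceSpace Ω) (φ : H1 Ω)
    (ψ : L2Vec Ω) : ℝ :=
  (∫ x in (Ω : Set E3), inner ℝ (g x) (ψ x)) - (∫ x in (Ω : Set E3), f x * toL2 φ x)
    + φ₁ (trace Ω φ)

/-- `(u, s) ∈ [L²(Ω)]³ × H¹_{0c}(Ω)` solves the extended weak formulation. -/
def IsExtendedWeakSolution {Ω : Opens E3} {L : ℕ} (Γ : Fin (L + 1) → Set E3)
    (ε : E3 → Matrix (Fin 3) (Fin 3) ℝ) (f : E3 → ℝ) (g : L2Vec Ω) (φ₁ : DualTraceSpace Ω)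
    (u : L2Vec Ω) (s : H1 Ω) : Prop :=
  MemH10c Γ s ∧ ∀ (φ : H1 Ω) (ψ curlψ : L2Vec Ω), MemH0Curl ψ curlψ →
    bilinearForm ε u s φ ψ curlψ = linearForm f g φ₁ φ ψ

end DivCurl

end

open DivCurl

/-!
Testing with `ψ = 0` gives the normal trace identity for `εu`, and hence `∇·(εu) = f` by restricting
to test functions. Testing with `φ = 0` gives `(u, ∇×ψ) + (ψ, ε∇s) = (g, ψ)` on `H₀(curl;Ω)`, so
`∇×u = g` follows once `s = 0`.

For `s = 0`, take `ψ = ∇s`. Modulo `H¹₀(Ω)`, an element of `H¹₀c(Ω)` is a combination of smooth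
functions that are locally constant near `∂Ω`; hence `∇s ∈ H₀(curl;Ω)` with `∇×∇s = 0`. Likewise
`(g, ∇s)` is a combination of the fluxes of `g`, all zero, so `(ε∇s, ∇s) = 0` and `∇s = 0`. Finally
`s = 0` since it can be extended by `0` across `Γ 0` into the exterior region while keeping a
vanishing weak gradient.
-/

namespace DivCurl

/-! ### Gradients and test functions -/

section Gradient

variable {E : Type*} [NormedAddCommGroup E] [InnerProductSpace ℝ E] [CompleteSpace E]

theorem gradient_mul {a b : E → ℝ} {x : E} (ha : DifferentiableAt ℝ a x)
    (hb : DifferentiableAt ℝ b x) :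
    gradient (fun y => a y * b y) x = a x • gradient b x + b x • gradient a x := by
  simp only [gradient, fderiv_fun_mul ha hb, map_add, map_smul]

theorem gradient_comp {T : ℝ → ℝ} {a : E → ℝ} {x : E} (hT : DifferentiableAt ℝ T (a x))
    (ha : DifferentiableAt ℝ a x) :
    gradient (fun y => T (a y)) x = deriv T (a x) • gradient a x := by
  have h : HasFDerivAt (fun y => T (a y)) (deriv T (a x) • fderiv ℝ a x) x :=
    hT.hasDerivAt.comp_hasFDerivAt x ha.hasFDerivAt
  rw [gradient, h.fderiv, map_smul, gradient]

theorem gradient_apply {ι : Type*} [Fintype ι] [DecidableEq ι] (a : EuclideanSpace ℝ ι → ℝ)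
    (x : EuclideanSpace ℝ ι) (k : ι) :
    gradient a x k = fderiv ℝ a x (EuclideanSpace.single k 1) := by
  rw [← inner_gradient_left, EuclideanSpace.inner_single_right]
  simp

theorem continuousOn_gradient {U : Set E} (hU : IsOpen U) {a : E → ℝ} (ha : ContDiffOn ℝ 1 a U) :
    ContinuousOn (gradient a) U :=
  (InnerProductSpace.toDual ℝ E).symm.continuous.comp_continuousOn
    (ha.continuousOn_fderiv_of_isOpen hU le_rfl)

theorem continuous_gradient {a : E → ℝ} (ha : ContDiff ℝ 1 a) : Continuous (gradient a) :=
  continuousOn_univ.1 (continuousOn_gradient isOpen_univ ha.contDiffOn)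

variable {Ω : Opens E}

theorem gradient_eqOn {a b : E → ℝ} (h : Set.EqOn a b Ω) :
    Set.EqOn (gradient a) (gradient b) Ω := fun _ hx =>
  (eventuallyEq_of_mem (Ω.isOpen.mem_nhds hx) h).gradient_eq

theorem isBoundedLinearMap_toDual_symm :
    IsBoundedLinearMap ℝ (InnerProductSpace.toDual ℝ E).symm :=
  ⟨⟨map_add _, by simp⟩, 1, one_pos, fun l => by simp⟩

/-- The gradient of a test function, as a test field. -/
noncomputable def testGradient (η : 𝓓(Ω, ℝ)) : 𝓓(Ω, E) where
  toFun := gradient η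
  contDiff' := isBoundedLinearMap_toDual_symm.contDiff.comp
    (η.contDiff.fderiv_right (m := ∞) (by simp))
  hasCompactSupport' := (η.hasCompactSupport.fderiv ℝ).comp_left (map_zero _)
  tsupport_subset' := ((tsupport_comp_subset (map_zero _) _).trans
    (tsupport_fderiv_subset ℝ)).trans η.tsupport_subset

@[simp]
theorem coe_testGradient (η : 𝓓(Ω, ℝ)) : ⇑(testGradient η) = gradient η :=
  rfl

end Gradient

section TestFunction

variable {E : Type*} [NormedAddCommGroup E] [NormedSpace ℝ E] {Ω : Opens E}
  {F : Type*} [NormedAddCommGroup F] [NormedSpace ℝ F]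

theorem contDiff_of_tsupport {n : WithTop ℕ∞} {a : E → F}
    (h : ∀ x ∈ tsupport a, ContDiffAt ℝ n a x) : ContDiff ℝ n a :=
  contMDiff_iff_contDiff.1 (contMDiff_of_tsupport fun x hx => (h x hx).contMDiffAt)

theorem testFunction_eq_zero_of_notMem (η : 𝓓(Ω, F)) {x : E} (hx : x ∉ Ω) : η x = 0 :=
  image_eq_zero_of_notMem_tsupport fun h => hx (η.tsupport_subset h)

/-- The product of a smooth function on `Ω` and a test function, as a test function. -/
noncomputable def testSMul (w : E → ℝ) (hw : ContDiffOn ℝ ∞ w Ω) (η : 𝓓(Ω, F)) : 𝓓(Ω, F) where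
  toFun x := w x • η x
  contDiff' := contDiff_of_tsupport fun _ hx =>
    (hw.contDiffAt (Ω.isOpen.mem_nhds
      (η.tsupport_subset (tsupport_smul_subset_right w η hx)))).smul η.contDiff.contDiffAt
  hasCompactSupport' := η.hasCompactSupport.smul_left
  tsupport_subset' := (tsupport_smul_subset_right w η).trans η.tsupport_subset

theorem testSMul_apply (w : E → ℝ) (hw : ContDiffOn ℝ ∞ w Ω) (η : 𝓓(Ω, F)) (x : E) :
    testSMul w hw η x = w x • η x :=
  rfl

theorem exists_testFunction_eqOn [ProperSpace E] (hbdd : Bornology.IsBounded (Ω : Set E))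
    {w : E → F} (hw : ContDiffOn ℝ ∞ w Ω)
    (h0 : ∀ y ∈ frontier (Ω : Set E), ∀ᶠ x in 𝓝[(Ω : Set E)] y, w x = 0) :
    ∃ η : 𝓓(Ω, F), Set.EqOn η w Ω := by
  classical
  set k : E → F := (Ω : Set E).indicator w
  have hkΩ : Set.EqOn k w Ω := fun x hx => Set.indicator_of_mem hx w
  have hsub : tsupport k ⊆ Ω := by
    intro x hx
    by_contra hxΩ
    have hxc : x ∈ closure (Ω : Set E) :=
      closure_mono Set.support_indicator_subset hx
    have hwx : ∀ᶠ z in 𝓝[(Ω : Set E)] x, w z = 0 := h0 x (Ω.isOpen.frontier_eq ▸ ⟨hxc, hxΩ⟩)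
    refine notMem_tsupport_iff_eventuallyEq.2 ?_ hx
    filter_upwards [eventually_nhdsWithin_iff.1 hwx] with z hz
    exact Set.indicator_apply_eq_zero.2 hz
  have hsmooth : ContDiff ℝ ∞ k := contDiff_of_tsupport fun x hx => by
    have hΩ : (Ω : Set E) ∈ 𝓝 x := Ω.isOpen.mem_nhds (hsub hx)
    exact (hw.contDiffAt hΩ).congr_of_eventuallyEq (eventuallyEq_of_mem hΩ hkΩ)
  have hcompact : HasCompactSupport k :=
    Metric.isCompact_of_isClosed_isBounded (isClosed_tsupport k) (hbdd.subset hsub)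
  exact ⟨⟨k, hsmooth, hcompact, hsub⟩, hkΩ⟩

end TestFunction

section SMulIntegral

variable {E : Type*} [NormedAddCommGroup E] [NormedSpace ℝ E] [MeasurableSpace E] {μ : Measure E}
  {Ω : Opens E} {F : Type*} [NormedAddCommGroup F] [NormedSpace ℝ F]

theorem setIntegral_testFunction_smul (b : E → F) (η : 𝓓(Ω, ℝ)) :
    ∫ x in (Ω : Set E), η x • b x ∂μ = ∫ x, η x • b x ∂μ :=
  setIntegral_eq_integral_of_forall_compl_eq_zero fun x hx => by
    rw [testFunction_eq_zero_of_notMem η hx, zero_smul]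

theorem integrable_testFunction_smul [OpensMeasurableSpace E] {b : E → F}
    (hb : LocallyIntegrableOn b Ω μ) (η : 𝓓(Ω, ℝ)) : Integrable (fun x => η x • b x) μ :=
  η.integrable_bilin (ContinuousLinearMap.lsmul ℝ ℝ) hb

theorem ae_eq_of_forall_integral_testFunction_smul_eq [FiniteDimensional ℝ E] [BorelSpace E]
    [CompleteSpace F] {b b' : E → F}
    (hb : LocallyIntegrableOn b Ω μ) (hb' : LocallyIntegrableOn b' Ω μ)
    (h : ∀ η : 𝓓(Ω, ℝ), ∫ x in (Ω : Set E), η x • b x ∂μ = ∫ x in (Ω : Set E), η x • b' x ∂μ) :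
    b =ᵐ[μ.restrict (Ω : Set E)] b' := by
  have hzero : ∀ᵐ x ∂μ, x ∈ (Ω : Set E) → (b - b') x = 0 := by
    refine Ω.isOpen.ae_eq_zero_of_integral_contDiff_smul_eq_zero (hb.sub hb') fun η hη hc hs => ?_
    let θ : 𝓓(Ω, ℝ) := ⟨η, hη, hc, hs⟩
    have hθ : ∫ x, θ x • b x ∂μ = ∫ x, θ x • b' x ∂μ := by
      simpa only [setIntegral_testFunction_smul] using h θ
    change ∫ x, θ x • (b x - b' x) ∂μ = 0
    simp only [smul_sub]
    rw [integral_sub (integrable_testFunction_smul hb θ) (integrable_testFunction_smul hb' θ), hθ,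
      sub_self]
  rw [EventuallyEq, ae_restrict_iff' Ω.isOpen.measurableSet]
  filter_upwards [hzero] with x hx hxΩ
  exact sub_eq_zero.1 (hx hxΩ)

end SMulIntegral

section IntegrationByParts

variable {E : Type*} [NormedAddCommGroup E] [InnerProductSpace ℝ E] [FiniteDimensional ℝ E]
  [MeasurableSpace E] [BorelSpace E] {μ : Measure E} [μ.IsAddHaarMeasure] {Ω : Opens E}

theorem integral_smul_gradient {w : E → ℝ} (hw : ContDiffOn ℝ 1 w Ω)
    (η : 𝓓(Ω, ℝ)) :
    ∫ x, w x • gradient η x ∂μ = - ∫ x, η x • gradient w x ∂μ := by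
  have hi₁ : Integrable (fun x => w x • gradient η x) μ := by
    simpa using (testGradient η).integrable_bilin (ContinuousLinearMap.lsmul ℝ ℝ).flip
      (hw.continuousOn.locallyIntegrableOn (μ := μ) Ω.isOpen.measurableSet)
  have hi₂ : Integrable (fun x => η x • gradient w x) μ :=
    integrable_testFunction_smul
      ((continuousOn_gradient Ω.isOpen hw).locallyIntegrableOn Ω.isOpen.measurableSet) η
  refine ext_inner_left ℝ fun v => ?_
  have h₁ (x : E) : inner ℝ v (w x • gradient η x) = w x * fderiv ℝ η x v := by
    simp [inner_smul_right, inner_gradient_right]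
  have h₂ (x : E) : inner ℝ v (η x • gradient w x) = fderiv ℝ w x v * η x := by
    simp [inner_smul_right, inner_gradient_right, mul_comm]
  rw [inner_neg_right, ← integral_inner hi₁, ← integral_inner hi₂]
  simp only [h₁, h₂]
  refine integral_mul_fderiv_eq_neg_fderiv_mul_of_integrable ?_ ?_ ?_ ?_ fun x _ =>
    η.contDiff.differentiable (by simp) x
  · exact (hi₂.const_inner v).congr (.of_forall h₂)
  · exact (hi₁.const_inner v).congr (.of_forall h₁)
  · simpa only [smul_eq_mul, mul_comm] using
      integrable_testFunction_smul
        (hw.continuousOn.locallyIntegrableOn (μ := μ) Ω.isOpen.measurableSet) η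
  · exact fun x hx => (hw.contDiffAt (Ω.isOpen.mem_nhds (η.tsupport_subset hx))).differentiableAt
      one_ne_zero

theorem setIntegral_smul_gradient {w : E → ℝ} (hw : ContDiffOn ℝ 1 w Ω)
    (η : 𝓓(Ω, ℝ)) :
    ∫ x in (Ω : Set E), w x • gradient η x ∂μ = - ∫ x in (Ω : Set E), η x • gradient w x ∂μ := by
  rw [setIntegral_testFunction_smul, ← integral_smul_gradient hw η]
  refine setIntegral_eq_integral_of_forall_compl_eq_zero fun x hx => ?_
  rw [← coe_testGradient, testFunction_eq_zero_of_notMem _ hx, smul_zero]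

theorem setIntegral_gradient_testFunction (η : 𝓓(Ω, ℝ)) :
    ∫ x in (Ω : Set E), gradient η x ∂μ = 0 := by
  simpa using setIntegral_smul_gradient (μ := μ) (w := fun _ => 1) contDiffOn_const η

end IntegrationByParts

/-! ### The Sobolev space -/

section Lp

variable {α : Type*} [MeasurableSpace α] {μ : Measure α} {F : Type*} [NormedAddCommGroup F]

theorem locallyIntegrableOn_of_memLp [TopologicalSpace α] [OpensMeasurableSpace α]
    [IsLocallyFiniteMeasure μ] {s : Set α} {b : α → F} {p : ℝ≥0∞} (hp : 1 ≤ p)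
    (hb : MemLp b p (μ.restrict s)) : LocallyIntegrableOn b s μ :=
  locallyIntegrableOn_of_locallyIntegrable_restrict (hb.locallyIntegrable hp)

theorem memLp_restrict_of_continuous [PseudoMetricSpace α] [ProperSpace α] [BorelSpace α]
    [SecondCountableTopology F] [IsFiniteMeasureOnCompacts μ] {s : Set α}
    (hs : Bornology.IsBounded s) {a : α → F} (ha : Continuous a) (p : ℝ≥0∞) :
    MemLp a p (μ.restrict s) := by
  obtain ⟨C, hC⟩ := hs.isCompact_closure.exists_bound_of_continuousOn ha.continuousOn
  have : IsFiniteMeasure (μ.restrict (closure s)) :=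
    ⟨by simpa using hs.isCompact_closure.measure_lt_top⟩
  have h : MemLp a p (μ.restrict (closure s)) := MemLp.of_bound ha.aestronglyMeasurable C
    ((ae_restrict_mem isClosed_closure.measurableSet).mono hC)
  exact h.mono_measure (Measure.restrict_mono_set μ subset_closure)

variable [NormedSpace ℝ F] {G H : Type*} [NormedAddCommGroup G] [NormedSpace ℝ G]
  [NormedAddCommGroup H] [NormedSpace ℝ H]

theorem coeFn_holder_toLp {p q r : ℝ≥0∞} [ENNReal.HolderTriple p q r]
    (B : F →L[ℝ] G →L[ℝ] H) {a : α → F} (ha : MemLp a p μ) (f : Lp G q μ) :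
    B.holder r (ha.toLp a) f =ᵐ[μ] fun x => B (a x) (f x) := by
  filter_upwards [B.coeFn_holder (r := r) (ha.toLp a) f, ha.coeFn_toLp] with x hx hax
  rw [hx, hax]

theorem continuous_integral_bilin {p q : ℝ≥0∞} [p.HolderConjugate q] [Fact (1 ≤ p)]
    [Fact (1 ≤ q)] [CompleteSpace H] (B : F →L[ℝ] G →L[ℝ] H) {b : α → G} (hb : MemLp b q μ) :
    Continuous fun f : Lp F p μ => ∫ x, B (f x) (b x) ∂μ := by
  have h (f : Lp F p μ) : B.lpPairing μ p q f (hb.toLp b) = ∫ x, B (f x) (b x) ∂μ := by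
    rw [B.lpPairing_eq_integral]
    exact integral_congr_ae (hb.coeFn_toLp.mono fun x hx => by simp only [hx])
  exact ((B.lpPairing μ p q).flip (hb.toLp b)).continuous.congr h

theorem tendsto_Lp_two_of_dominated {F : Type*} [NormedAddCommGroup F] [InnerProductSpace ℝ F]
    {f : ℕ → Lp F 2 μ} {f₀ : Lp F 2 μ} {b : α → ℝ} (hb : MemLp b 2 μ)
    (hbound : ∀ n, ∀ᵐ x ∂μ, ‖f n x - f₀ x‖ ≤ b x)
    (hlim : ∀ᵐ x ∂μ, Tendsto (fun n => f n x) atTop (𝓝 (f₀ x))) :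
    Tendsto f atTop (𝓝 f₀) := by
  have hsq (n : ℕ) : ‖f n - f₀‖ ^ 2 = ∫ x, ‖f n x - f₀ x‖ ^ 2 ∂μ := by
    rw [← real_inner_self_eq_norm_sq, L2.inner_def]
    refine integral_congr_ae ?_
    filter_upwards [Lp.coeFn_sub (f n) f₀] with x hx
    rw [hx, real_inner_self_eq_norm_sq, Pi.sub_apply]
  have hlim_sq : Tendsto (fun n => ∫ x, ‖f n x - f₀ x‖ ^ 2 ∂μ) atTop (𝓝 (∫ _, (0 : ℝ) ∂μ)) := by
    refine tendsto_integral_of_dominated_convergence (fun x => b x ^ 2)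
      (fun n => (((Lp.aestronglyMeasurable _).sub (Lp.aestronglyMeasurable _)).norm.pow 2))
      hb.integrable_sq (fun n => ?_) ?_
    · filter_upwards [hbound n] with x hx
      rw [Real.norm_of_nonneg (by positivity)]
      gcongr
    · filter_upwards [hlim] with x hx
      simpa using (tendsto_iff_norm_sub_tendsto_zero.1 hx).pow 2
  rw [tendsto_iff_norm_sub_tendsto_zero]
  simp_rw [integral_zero, ← hsq] at hlim_sq
  simpa [Real.sqrt_sq (norm_nonneg _)] using hlim_sq.sqrt

end Lp

section H1

variable {Ω : Opens E3}

/-- `toL2` as a continuous linear map. -/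
noncomputable def toL2L (Ω : Opens E3) : H1 Ω →L[ℝ] L2 Ω :=
  (WithLp.fstL 2 ℝ (L2 Ω) (L2Vec Ω)).comp (H1 Ω).subtypeL

/-- The weak gradient as a continuous linear map. -/
noncomputable def gradL (Ω : Opens E3) : H1 Ω →L[ℝ] L2Vec Ω :=
  (WithLp.sndL 2 ℝ (L2 Ω) (L2Vec Ω)).comp (H1 Ω).subtypeL

@[simp]
theorem gradL_apply (v : H1 Ω) : gradL Ω v = grad v :=
  rfl

theorem setIntegral_toL2_smul_gradient (v : H1 Ω) (η : 𝓓(Ω, ℝ)) :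
    ∫ x in (Ω : Set E3), toL2 v x • gradient η x = - ∫ x in (Ω : Set E3), η x • grad v x :=
  v.2 η

theorem grad_ae_eq {v : H1 Ω} {b : E3 → E3} (hb : LocallyIntegrableOn b Ω)
    (h : ∀ η : 𝓓(Ω, ℝ), ∫ x in (Ω : Set E3), toL2 v x • gradient η x
      = - ∫ x in (Ω : Set E3), η x • b x) :
    grad v =ᵐ[volume.restrict (Ω : Set E3)] b :=
  ae_eq_of_forall_integral_testFunction_smul_eq
    (locallyIntegrableOn_of_memLp one_le_two (Lp.memLp _)) hb
    fun η => neg_injective ((setIntegral_toL2_smul_gradient v η).symm.trans (h η))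

theorem H1.ext {v w : H1 Ω} (h : toL2 v = toL2 w) : v = w := by
  have hgrad : grad v = grad w :=
    Lp.ext <| grad_ae_eq (locallyIntegrableOn_of_memLp one_le_two (Lp.memLp _)) fun η => by
      rw [h, setIntegral_toL2_smul_gradient]
  exact Subtype.ext (WithLp.ofLp_injective 2 (Prod.ext h hgrad))

theorem grad_ae_eq_gradient {v : H1 Ω} {w : E3 → ℝ} (hw : ContDiffOn ℝ 1 w Ω)
    (hv : toL2 v =ᵐ[volume.restrict (Ω : Set E3)] w) :
    grad v =ᵐ[volume.restrict (Ω : Set E3)] gradient w := by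
  refine grad_ae_eq ((continuousOn_gradient Ω.isOpen hw).locallyIntegrableOn
    Ω.isOpen.measurableSet) fun η => ?_
  rw [← setIntegral_smul_gradient hw η]
  exact integral_congr_ae (hv.mono fun x hx => by simp only [hx])

theorem exists_H1 {a : E3 → ℝ} {b : E3 → E3} (ha : MemLp a 2 (volume.restrict (Ω : Set E3)))
    (hb : MemLp b 2 (volume.restrict (Ω : Set E3)))
    (h : ∀ η : 𝓓(Ω, ℝ), ∫ x in (Ω : Set E3), a x • gradient η x
      = - ∫ x in (Ω : Set E3), η x • b x) :
    ∃ v : H1 Ω, toL2 v =ᵐ[volume.restrict (Ω : Set E3)] a ∧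
      grad v =ᵐ[volume.restrict (Ω : Set E3)] b := by
  refine ⟨⟨WithLp.toLp 2 (ha.toLp a, hb.toLp b), fun η => ?_⟩, ha.coeFn_toLp, hb.coeFn_toLp⟩
  calc ∫ x in (Ω : Set E3), (ha.toLp a) x • gradient η x
      = ∫ x in (Ω : Set E3), a x • gradient η x :=
        integral_congr_ae (ha.coeFn_toLp.mono fun x hx => by simp only [hx])
    _ = - ∫ x in (Ω : Set E3), η x • b x := h η
    _ = - ∫ x in (Ω : Set E3), η x • (hb.toLp b) x := by
        congr 1
        exact integral_congr_ae (hb.coeFn_toLp.mono fun x hx => by simp only [hx])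

theorem exists_H1_of_testFunction (η : 𝓓(Ω, ℝ)) :
    ∃ v : H1 Ω, toL2 v =ᵐ[volume.restrict (Ω : Set E3)] η ∧
      grad v =ᵐ[volume.restrict (Ω : Set E3)] gradient η :=
  exists_H1 (memLp_test η) (memLp_gradient_test η) fun θ =>
    setIntegral_smul_gradient (η.contDiff.of_le (by simp)).contDiffOn θ

theorem exists_H1_of_contDiff (hbdd : Bornology.IsBounded (Ω : Set E3)) {w : E3 → ℝ}
    (hw : ContDiff ℝ 1 w) : ∃ v : H1 Ω, toL2 v =ᵐ[volume.restrict (Ω : Set E3)] w := by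
  obtain ⟨v, hv, -⟩ := exists_H1 (Ω := Ω)
    (memLp_restrict_of_continuous hbdd hw.continuous 2)
    (memLp_restrict_of_continuous hbdd (continuous_gradient hw) 2)
    fun η => setIntegral_smul_gradient hw.contDiffOn η
  exact ⟨v, hv⟩

theorem isClosed_H1 : IsClosed (H1 Ω : Set (WithLp 2 (L2 Ω × L2Vec Ω))) := by
  have h : (H1 Ω : Set (WithLp 2 (L2 Ω × L2Vec Ω))) = ⋂ η : 𝓓(Ω, ℝ),
      {p | ∫ x in (Ω : Set E3), p.fst x • gradient η x
        = - ∫ x in (Ω : Set E3), η x • p.snd x} :=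
    (Set.ofPred_forall _)
  rw [h]
  refine isClosed_iInter fun η => isClosed_eq ?_ (Continuous.neg ?_)
  · exact (continuous_integral_bilin (ContinuousLinearMap.lsmul ℝ ℝ)
      (memLp_gradient_test η)).comp (WithLp.fstL 2 ℝ (L2 Ω) (L2Vec Ω)).continuous
  · exact (continuous_integral_bilin (ContinuousLinearMap.lsmul ℝ ℝ).flip
      (memLp_test η)).comp (WithLp.sndL 2 ℝ (L2 Ω) (L2Vec Ω)).continuous

theorem H1.tendsto_of_tendsto_toL2_of_tendsto_grad {ι : Type*} {l : Filter ι} [l.NeBot]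
    {V : ι → H1 Ω} {v : H1 Ω} {q : L2Vec Ω} (h : Tendsto (fun i => toL2 (V i)) l (𝓝 (toL2 v)))
    (hq : Tendsto (fun i => grad (V i)) l (𝓝 q)) : Tendsto V l (𝓝 v) := by
  have hlim : Tendsto (fun i => (V i : WithLp 2 (L2 Ω × L2Vec Ω))) l
      (𝓝 (WithLp.toLp 2 (toL2 v, q))) :=
    ((WithLp.prod_continuous_toLp 2 _ _).tendsto _).comp (h.prodMk_nhds hq)
  have hmem : WithLp.toLp 2 (toL2 v, q) ∈ H1 Ω :=
    isClosed_H1.mem_of_tendsto hlim (.of_forall fun i => (V i).2)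
  have hv : v = ⟨_, hmem⟩ := H1.ext rfl
  rw [hv, tendsto_subtype_rng]
  exact hlim

theorem setIntegral_mul_toL2_smul_gradient {ζ : E3 → ℝ} (hζ : ContDiffOn ℝ ∞ ζ Ω) (v : H1 Ω)
    (η : 𝓓(Ω, ℝ)) :
    ∫ x in (Ω : Set E3), (ζ x * toL2 v x) • gradient η x
      = - ∫ x in (Ω : Set E3), η x • (ζ x • grad v x + toL2 v x • gradient ζ x) := by
  let θ : 𝓓(Ω, ℝ) := testSMul ζ hζ η
  have hθ : ∀ᵐ x ∂volume.restrict (Ω : Set E3),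
      gradient θ x = ζ x • gradient η x + η x • gradient ζ x := by
    filter_upwards [ae_restrict_mem Ω.isOpen.measurableSet] with x hx
    exact gradient_mul ((hζ.contDiffAt (Ω.isOpen.mem_nhds hx)).differentiableAt (by simp))
      (η.contDiff.differentiable (by simp) x)
  have hθgrad : Integrable (fun x => toL2 v x • gradient θ x) (volume.restrict (Ω : Set E3)) :=
    integrable_smul_of_memLp (Lp.memLp _) (memLp_gradient_test θ)
  have hi : Integrable (fun x => η x • (toL2 v x • gradient ζ x))
      (volume.restrict (Ω : Set E3)) := by
    let κ : 𝓓(Ω, E3) := testSMul ζ hζ (testGradient η)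
    have hκ : MemLp κ 2 (volume.restrict (Ω : Set E3)) :=
      (κ.continuous.memLp_of_hasCompactSupport κ.hasCompactSupport).restrict _
    refine (hθgrad.sub (integrable_smul_of_memLp (Lp.memLp (toL2 v)) hκ)).congr
      (hθ.mono fun x hx => ?_)
    simp only [Pi.sub_apply, κ, testSMul_apply, coe_testGradient, hx]
    module
  have hθv : Integrable (fun x => θ x • grad v x) (volume.restrict (Ω : Set E3)) :=
    integrable_smul_of_memLp (memLp_test θ) (Lp.memLp _)
  calc ∫ x in (Ω : Set E3), (ζ x * toL2 v x) • gradient η x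
      = ∫ x in (Ω : Set E3), (toL2 v x • gradient θ x - η x • (toL2 v x • gradient ζ x)) :=
        integral_congr_ae (hθ.mono fun x hx => by simp only [hx]; module)
    _ = - ∫ x in (Ω : Set E3), (θ x • grad v x + η x • (toL2 v x • gradient ζ x)) := by
        rw [integral_sub hθgrad hi, integral_add hθv hi, setIntegral_toL2_smul_gradient]
        abel
    _ = - ∫ x in (Ω : Set E3), η x • (ζ x • grad v x + toL2 v x • gradient ζ x) := by
        congr 1
        refine integral_congr_ae (.of_forall fun x => ?_)
        simp only [θ, testSMul_apply, smul_eq_mul]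
        module

theorem exists_mulH1 {ζ : E3 → ℝ} (hζ : ContDiffOn ℝ ∞ ζ Ω)
    (hζ_top : MemLp ζ ∞ (volume.restrict (Ω : Set E3)))
    (hgrad_top : MemLp (gradient ζ) ∞ (volume.restrict (Ω : Set E3))) :
    ∃ M : H1 Ω →L[ℝ] H1 Ω, ∀ v,
      toL2 (M v) =ᵐ[volume.restrict (Ω : Set E3)] fun x => ζ x * toL2 v x := by
  let μ := volume.restrict (Ω : Set E3)
  let T : H1 Ω →L[ℝ] L2 Ω := ((ContinuousLinearMap.mul ℝ ℝ).holderL μ ∞ 2 2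
    (hζ_top.toLp ζ)).comp (toL2L Ω)
  let S : H1 Ω →L[ℝ] L2Vec Ω :=
    ((ContinuousLinearMap.lsmul ℝ ℝ).holderL μ ∞ 2 2 (hζ_top.toLp ζ)).comp (gradL Ω)
      + ((ContinuousLinearMap.lsmul ℝ ℝ).flip.holderL μ ∞ 2 2 (hgrad_top.toLp _)).comp (toL2L Ω)
  have hT (v : H1 Ω) : T v =ᵐ[μ] fun x => ζ x * toL2 v x :=
    coeFn_holder_toLp (r := 2) (ContinuousLinearMap.mul ℝ ℝ) hζ_top (toL2 v)
  have hS (v : H1 Ω) : S v =ᵐ[μ] fun x => ζ x • grad v x + toL2 v x • gradient ζ x :=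
    (Lp.coeFn_add _ _).trans <|
      (coeFn_holder_toLp (r := 2) (ContinuousLinearMap.lsmul ℝ ℝ) hζ_top (grad v)).add
        (coeFn_holder_toLp (r := 2) (ContinuousLinearMap.lsmul ℝ ℝ).flip hgrad_top (toL2 v))
  have hmem (v : H1 Ω) : WithLp.toLp 2 (T v, S v) ∈ H1 Ω := fun η => by
    calc ∫ x in (Ω : Set E3), T v x • gradient η x
        = ∫ x in (Ω : Set E3), (ζ x * toL2 v x) • gradient η x :=
          integral_congr_ae ((hT v).mono fun x hx => by simp only [hx])
      _ = - ∫ x in (Ω : Set E3), η x • (ζ x • grad v x + toL2 v x • gradient ζ x) :=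
          setIntegral_mul_toL2_smul_gradient hζ v η
      _ = - ∫ x in (Ω : Set E3), η x • S v x := by
          congr 1
          exact integral_congr_ae ((hS v).mono fun x hx => by simp only [hx])
  exact ⟨((WithLp.prodContinuousLinearEquiv 2 ℝ (L2 Ω) (L2Vec Ω)).symm.toContinuousLinearMap.comp
    (T.prod S)).codRestrict (H1 Ω) hmem, hT⟩

end H1

/-! ### Smooth truncation -/

section Truncation

/-- A smooth odd function that vanishes near `0` and is the identity away from `0`. -/
noncomputable def shrink (t : ℝ) : ℝ := t * Real.smoothTransition (t ^ 2 - 1)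

theorem contDiff_shrink : ContDiff ℝ ∞ shrink :=
  contDiff_id.mul (Real.smoothTransition.contDiff.comp ((contDiff_id.pow 2).sub contDiff_const))

theorem abs_shrink_le (t : ℝ) : |shrink t| ≤ |t| := by
  rw [shrink, abs_mul, abs_of_nonneg (Real.smoothTransition.nonneg _)]
  exact mul_le_of_le_one_right (abs_nonneg _) (Real.smoothTransition.le_one _)

theorem shrink_eq_zero {t : ℝ} (h : t ^ 2 ≤ 1) : shrink t = 0 := by
  rw [shrink, Real.smoothTransition.zero_of_nonpos (by linarith), mul_zero]

theorem shrink_eq_self {t : ℝ} (h : 2 ≤ t ^ 2) : shrink t = t := by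
  rw [shrink, Real.smoothTransition.one_of_one_le (by linarith), mul_one]

theorem exists_abs_deriv_shrink_le : ∃ C : ℝ, ∀ t, |deriv shrink t| ≤ C := by
  have hcont : Continuous (deriv shrink) := contDiff_shrink.continuous_deriv (by simp)
  obtain ⟨C, hC⟩ := (isCompact_Icc (a := (-2 : ℝ)) (b := 2)).exists_bound_of_continuousOn
    hcont.continuousOn
  refine ⟨max C 1, fun t => ?_⟩
  by_cases ht : t ∈ Set.Icc (-2 : ℝ) 2
  · exact (hC t ht).trans (le_max_left _ _)
  have hfar : 2 < t ^ 2 := by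
    by_contra! hle
    exact ht (abs_le.1 (abs_le_of_sq_le_sq (by linarith) (by norm_num)))
  have hid : shrink =ᶠ[𝓝 t] id :=
    ((continuous_pow 2).tendsto t |>.eventually_const_lt hfar).mono fun _ h => shrink_eq_self h.le
  simp [hid.deriv_eq]

/-- Smooth approximations of the identity of `ℝ` that vanish near `0`. -/
noncomputable def truncation (n : ℕ) (t : ℝ) : ℝ := shrink ((n + 1) * t) / (n + 1)

theorem contDiff_truncation (n : ℕ) : ContDiff ℝ ∞ (truncation n) :=
  (contDiff_shrink.comp (contDiff_const.mul contDiff_id)).div_const _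

theorem abs_truncation_le (n : ℕ) (t : ℝ) : |truncation n t| ≤ |t| := by
  have hn : (0 : ℝ) < n + 1 := by positivity
  rw [truncation, abs_div, abs_of_pos hn, div_le_iff₀ hn]
  calc |shrink ((n + 1) * t)| ≤ |(n + 1) * t| := abs_shrink_le _
    _ = |t| * (n + 1) := by rw [abs_mul, abs_of_pos hn, mul_comm]

theorem truncation_eventually_eq_zero (n : ℕ) : truncation n =ᶠ[𝓝 0] fun _ => 0 := by
  have h : Tendsto (fun t : ℝ => ((n + 1) * t) ^ 2) (𝓝 0) (𝓝 0) :=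
    Continuous.tendsto' (by fun_prop) _ _ (by simp)
  filter_upwards [h.eventually_lt_const one_pos] with t ht
  rw [truncation, shrink_eq_zero ht.le, zero_div]

theorem eventually_truncation_eventuallyEq_id {t : ℝ} (ht : t ≠ 0) :
    ∀ᶠ n : ℕ in atTop, truncation n =ᶠ[𝓝 t] id := by
  have hlim : Tendsto (fun n : ℕ => (n + 1) * |t|) atTop atTop :=
    (tendsto_natCast_atTop_atTop.atTop_add (tendsto_const_nhds (x := (1 : ℝ)))).atTop_mul_const
      (abs_pos.2 ht)
  filter_upwards [hlim.eventually_gt_atTop 2] with n hn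
  have hfar : 2 < ((n + 1) * t) ^ 2 := by
    rw [← sq_abs, abs_mul, abs_of_pos (by positivity : (0 : ℝ) < n + 1)]
    nlinarith
  have hcont : Continuous fun s : ℝ => ((n + 1) * s) ^ 2 := by fun_prop
  filter_upwards [(hcont.tendsto t).eventually_const_lt hfar] with s hs
  rw [truncation, shrink_eq_self hs.le, mul_div_cancel_left₀ _ (by positivity), id]

theorem exists_abs_deriv_truncation_le : ∃ C : ℝ, ∀ n t, |deriv (truncation n) t| ≤ C := by
  obtain ⟨C, hC⟩ := exists_abs_deriv_shrink_le
  refine ⟨C, fun n t => ?_⟩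
  have hshrink : HasDerivAt shrink (deriv shrink ((n + 1) * t)) ((n + 1) * t) :=
    (contDiff_shrink.differentiable (by simp) _).hasDerivAt
  have h : HasDerivAt (truncation n) (deriv shrink ((n + 1) * t) * ((n + 1) * 1) / (n + 1)) t :=
    (hshrink.comp t ((hasDerivAt_id t).const_mul ((n : ℝ) + 1))).div_const _
  rw [h.deriv, mul_one, mul_div_cancel_right₀ _ (by positivity)]
  exact hC _

theorem tendsto_truncation (t : ℝ) : Tendsto (fun n => truncation n t) atTop (𝓝 t) := by
  rcases eq_or_ne t 0 with rfl | ht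
  · exact tendsto_const_nhds.congr fun n => (truncation_eventually_eq_zero n).eq_of_nhds.symm
  · exact tendsto_const_nhds.congr' <| (eventually_truncation_eventuallyEq_id ht).mono
      fun n hn => hn.eq_of_nhds.symm

theorem tendsto_deriv_truncation (t : ℝ) :
    Tendsto (fun n => deriv (truncation n) t) atTop (𝓝 (if t = 0 then 0 else 1)) := by
  split_ifs with ht
  · refine tendsto_const_nhds.congr fun n => ?_
    rw [ht, (truncation_eventually_eq_zero n).deriv_eq, deriv_const]
  · refine tendsto_const_nhds.congr' ((eventually_truncation_eventuallyEq_id ht).mono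
      fun n hn => ?_)
    exact (hn.deriv_eq.trans (deriv_id t)).symm

variable {Ω : Opens E3}

theorem exists_testFunction_truncation (hbdd : Bornology.IsBounded (Ω : Set E3))
    {w : E3 → ℝ} (hw : ContDiffOn ℝ ∞ w Ω)
    (h0 : ∀ y ∈ frontier (Ω : Set E3), Tendsto w (𝓝[(Ω : Set E3)] y) (𝓝 0)) (n : ℕ) :
    ∃ η : 𝓓(Ω, ℝ), Set.EqOn η (fun x => truncation n (w x)) Ω :=
  exists_testFunction_eqOn hbdd ((contDiff_truncation n).comp_contDiffOn hw) fun y hy =>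
    (h0 y hy).eventually (truncation_eventually_eq_zero n)

/- The pointwise limit of the gradients is `0` on `{v = 0}` and `∇v` elsewhere. That the two agree
need not be shown: `H¹(Ω)` is closed, so the limit is the weak gradient of `v`. -/
theorem H1.tendsto_of_truncation {v : H1 Ω} {V : ℕ → H1 Ω}
    (hV : ∀ n, toL2 (V n) =ᵐ[volume.restrict (Ω : Set E3)] fun x => truncation n (toL2 v x))
    (hgradV : ∀ n, grad (V n) =ᵐ[volume.restrict (Ω : Set E3)]
      fun x => deriv (truncation n) (toL2 v x) • grad v x) :
    Tendsto V atTop (𝓝 v) := by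
  obtain ⟨C, hC⟩ := exists_abs_deriv_truncation_le
  have hmeas : MeasurableSet {x | toL2 v x ≠ 0} :=
    (Lp.stronglyMeasurable (toL2 v)).measurable (measurableSet_singleton 0).compl
  have hq : MemLp ({x | toL2 v x ≠ 0}.indicator (grad v)) 2 (volume.restrict (Ω : Set E3)) :=
    (Lp.memLp (grad v)).indicator hmeas
  refine H1.tendsto_of_tendsto_toL2_of_tendsto_grad (q := hq.toLp _)
    (tendsto_Lp_two_of_dominated ((Lp.memLp (toL2 v)).norm.const_mul 2) (fun n => ?_) ?_)
    (tendsto_Lp_two_of_dominated ((Lp.memLp (grad v)).norm.const_mul (C + 1)) (fun n => ?_) ?_)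
  · filter_upwards [hV n] with x hx
    have h : ‖toL2 (V n) x‖ ≤ ‖toL2 v x‖ := hx ▸ abs_truncation_le n _
    linarith [norm_sub_le (toL2 (V n) x) (toL2 v x)]
  · filter_upwards [ae_all_iff.2 hV] with x hx
    simpa only [hx] using tendsto_truncation (toL2 v x)
  · filter_upwards [hgradV n, hq.coeFn_toLp] with x hx hqx
    have h : ‖grad (V n) x‖ ≤ C * ‖grad v x‖ := by
      rw [hx, norm_smul]
      gcongr
      exact hC n _
    have h' : ‖hq.toLp _ x‖ ≤ ‖grad v x‖ := hqx ▸ norm_indicator_le_norm_self _ _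
    linarith [norm_sub_le (grad (V n) x) (hq.toLp _ x)]
  · filter_upwards [ae_all_iff.2 hgradV, hq.coeFn_toLp] with x hx hqx
    have h := (tendsto_deriv_truncation (toL2 v x)).smul_const (grad v x)
    by_cases hv : toL2 v x = 0 <;> simpa [hx, hqx, hv] using h

theorem mem_H10_of_tendsto_zero (hbdd : Bornology.IsBounded (Ω : Set E3)) {v : H1 Ω}
    {w : E3 → ℝ} (hw : ContDiffOn ℝ ∞ w Ω) (hv : toL2 v =ᵐ[volume.restrict (Ω : Set E3)] w)
    (h0 : ∀ y ∈ frontier (Ω : Set E3), Tendsto w (𝓝[(Ω : Set E3)] y) (𝓝 0)) :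
    v ∈ H10 Ω := by
  choose η hη using exists_testFunction_truncation hbdd hw h0
  choose V hV hgradV using fun n => exists_H1_of_testFunction (η n)
  refine mem_closure_of_tendsto (H1.tendsto_of_truncation (V := V) (fun n => ?_) fun n => ?_)
    (.of_forall fun n => ⟨η n, hV n⟩)
  · filter_upwards [hV n, hv, ae_restrict_mem Ω.isOpen.measurableSet] with x hx hvx hxΩ
    rw [hx, hη n hxΩ, hvx]
  · filter_upwards [hgradV n, hv, grad_ae_eq_gradient (hw.of_le (by simp)) hv,
      ae_restrict_mem Ω.isOpen.measurableSet] with x hx hvx hgradx hxΩ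
    rw [hx, gradient_eqOn (hη n) hxΩ, hvx, hgradx]
    exact gradient_comp ((contDiff_truncation n).differentiable (by simp) _)
      ((hw.contDiffAt (Ω.isOpen.mem_nhds hxΩ)).differentiableAt (by simp))

end Truncation

/-! ### Boundary values -/

section BoundaryValue

variable {Ω : Opens E3} {v w : H1 Ω} {S T : Set E3} {α β : ℝ}

theorem exists_mulH1_of_contDiff (hbdd : Bornology.IsBounded (Ω : Set E3)) {ζ : E3 → ℝ}
    (hζ : ContDiff ℝ ∞ ζ) :
    ∃ M : H1 Ω →L[ℝ] H1 Ω, ∀ v,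
      toL2 (M v) =ᵐ[volume.restrict (Ω : Set E3)] fun x => ζ x * toL2 v x :=
  exists_mulH1 hζ.contDiffOn (memLp_restrict_of_continuous hbdd hζ.continuous ∞)
    (memLp_restrict_of_continuous hbdd (continuous_gradient (hζ.of_le (by simp))) ∞)

theorem HasBoundaryValue.zero : HasBoundaryValue (0 : H1 Ω) S 0 :=
  subset_closure ⟨fun _ => 0, contDiffOn_const,
    Lp.coeFn_zero ℝ 2 (volume.restrict (Ω : Set E3)), fun _ _ => tendsto_const_nhds⟩

theorem HasBoundaryValue.add (hv : HasBoundaryValue v S α) (hw : HasBoundaryValue w S β) :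
    HasBoundaryValue (v + w) S (α + β) := by
  refine map_mem_closure₂ continuous_add hv hw ?_
  rintro v ⟨a, ha, hva, ha_lim⟩ w ⟨b, hb, hwb, hb_lim⟩
  refine ⟨fun x => a x + b x, ha.add hb, ?_, fun y hy => (ha_lim y hy).add (hb_lim y hy)⟩
  exact (Lp.coeFn_add (toL2 v) (toL2 w)).trans (hva.add hwb)

theorem HasBoundaryValue.smul (c : ℝ) (hv : HasBoundaryValue v S α) :
    HasBoundaryValue (c • v) S (c * α) := by
  refine map_mem_closure (continuous_const_smul c) hv ?_
  rintro v ⟨a, ha, hva, ha_lim⟩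
  refine ⟨fun x => c * a x, contDiffOn_const.mul ha, ?_, fun y hy => (ha_lim y hy).const_mul c⟩
  exact (Lp.coeFn_smul c (toL2 v)).trans (hva.const_smul c)

theorem HasBoundaryValue.sum {ι : Type*} (s : Finset ι) {v : ι → H1 Ω} {α : ι → ℝ}
    (h : ∀ i ∈ s, HasBoundaryValue (v i) S (α i)) :
    HasBoundaryValue (∑ i ∈ s, v i) S (∑ i ∈ s, α i) := by
  induction s using Finset.cons_induction with
  | empty => simpa using HasBoundaryValue.zero
  | cons i s hi ih =>
    rw [Finset.sum_cons, Finset.sum_cons]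
    exact (h i (Finset.mem_cons_self i s)).add
      (ih fun j hj => h j (Finset.mem_cons_of_mem hj))

theorem exists_contDiff_separation {E : Type*} [NormedAddCommGroup E] [NormedSpace ℝ E]
    [FiniteDimensional ℝ E] {A B : Set E} (hA : IsClosed A) (hB : IsClosed B)
    (hAB : Disjoint A B) :
    ∃ ζ : E → ℝ, ContDiff ℝ ∞ ζ ∧ (∀ y ∈ A, ∀ᶠ x in 𝓝 y, ζ x = 0) ∧
      ∀ y ∈ B, ∀ᶠ x in 𝓝 y, ζ x = 1 := by
  obtain ⟨ζ, h0, h1, -⟩ := exists_contMDiffMap_zero_one_nhds_of_isClosed (n := ⊤)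
    (modelWithCornersSelf ℝ E) hA hB hAB
  exact ⟨ζ, ζ.contMDiff.contDiff, eventually_nhdsSet_iff_forall.1 h0,
    eventually_nhdsSet_iff_forall.1 h1⟩

theorem HasBoundaryValue.union (hbdd : Bornology.IsBounded (Ω : Set E3)) (hS : IsClosed S)
    (hT : IsClosed T) (hST : Disjoint S T) (hvS : HasBoundaryValue v S α)
    (hvT : HasBoundaryValue v T α) : HasBoundaryValue v (S ∪ T) α := by
  obtain ⟨ζ, hζ, hζS, hζT⟩ := exists_contDiff_separation hS hT hST
  obtain ⟨M, hM⟩ := exists_mulH1_of_contDiff hbdd hζ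
  -- Glue the approximations near `S` and near `T` with the cutoff: `v = (v - ζ v) + ζ v`.
  suffices h : v - M v + M v ∈ closure (classicalBoundaryValue Ω (S ∪ T) α) by
    rwa [sub_add_cancel] at h
  refine map_mem_closure₂ (f := fun a b => a - M a + M b) (by fun_prop) hvS hvT ?_
  rintro v ⟨a, ha, hva, ha_lim⟩ w ⟨b, hb, hwb, hb_lim⟩
  refine ⟨fun x => a x - ζ x * a x + ζ x * b x,
    (ha.sub (hζ.contDiffOn.mul ha)).add (hζ.contDiffOn.mul hb), ?_, ?_⟩
  · filter_upwards [Lp.coeFn_add (toL2 v - toL2 (M v)) (toL2 (M w)),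
      Lp.coeFn_sub (toL2 v) (toL2 (M v)), hM v, hM w, hva, hwb] with x hadd hsub hMv hMw hvx hwx
    refine hadd.trans ?_
    rw [Pi.add_apply, hsub, Pi.sub_apply, hMv, hMw, hvx, hwx]
  · rintro y (hy | hy)
    · refine (ha_lim y hy).congr' ?_
      filter_upwards [(hζS y hy).filter_mono nhdsWithin_le_nhds] with x hx
      simp [hx]
    · refine (hb_lim y hy).congr' ?_
      filter_upwards [(hζT y hy).filter_mono nhdsWithin_le_nhds] with x hx
      simp [hx]

theorem HasBoundaryValue.biUnion (hbdd : Bornology.IsBounded (Ω : Set E3)) {ι : Type*}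
    {s : Finset ι} (hs : s.Nonempty) {S : ι → Set E3} (hS : ∀ i, IsClosed (S i))
    (hdisj : Pairwise (Function.onFun Disjoint S)) (hv : ∀ i, HasBoundaryValue v (S i) α) :
    HasBoundaryValue v (⋃ i ∈ s, S i) α := by
  classical
  induction hs using Finset.Nonempty.cons_induction with
  | singleton i => simpa using hv i
  | cons i s hi _ ih =>
    rw [Finset.cons_eq_insert, Finset.set_biUnion_insert]
    refine (hv i).union hbdd (hS i) (s.finite_toSet.isClosed_biUnion fun j _ => hS j)
      (Set.disjoint_iUnion₂_right.2 fun j hj => hdisj ?_) ih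
    rintro rfl
    exact hi hj

theorem mul_mem_H10 (hbdd : Bornology.IsBounded (Ω : Set E3)) {ζ : E3 → ℝ}
    (hζ : ContDiff ℝ ∞ ζ) {M : H1 Ω →L[ℝ] H1 Ω}
    (hM : ∀ v, toL2 (M v) =ᵐ[volume.restrict (Ω : Set E3)] fun x => ζ x * toL2 v x)
    (hS : ∀ y ∈ frontier (Ω : Set E3) \ S, ∀ᶠ x in 𝓝 y, ζ x = 0)
    (hv : HasBoundaryValue v S 0) : M v ∈ H10 Ω := by
  have hclosed : IsClosed (H10 Ω : Set (H1 Ω)) := (testH1 Ω).isClosed_topologicalClosure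
  rw [← SetLike.mem_coe, ← hclosed.closure_eq]
  refine map_mem_closure M.continuous hv ?_
  rintro v ⟨w, hw, hvw, hw_lim⟩
  refine mem_H10_of_tendsto_zero hbdd (hζ.contDiffOn.mul hw) ?_ fun y hy => ?_
  · filter_upwards [hM v, hvw] with x hMx hx
    rw [hMx, hx]
  · by_cases hyS : y ∈ S
    · simpa using ((hζ.continuous.tendsto y).mono_left nhdsWithin_le_nhds).mul (hw_lim y hyS)
    · refine tendsto_const_nhds.congr' ?_
      filter_upwards [(hS y ⟨hy, hyS⟩).filter_mono nhdsWithin_le_nhds] with x hx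
      rw [hx, zero_mul]

theorem HasBoundaryValue.mem_H10 (hbdd : Bornology.IsBounded (Ω : Set E3))
    (hv : HasBoundaryValue v (frontier (Ω : Set E3)) 0) : v ∈ H10 Ω :=
  mul_mem_H10 hbdd (ζ := fun _ => 1) contDiff_const (M := ContinuousLinearMap.id ℝ (H1 Ω))
    (fun v => by simp) (fun _ hy => absurd hy.1 hy.2) hv

theorem apply_eq_zero_of_mem_H10 {F : Type*} [AddCommGroup F] [Module ℝ F] [TopologicalSpace F]
    [T1Space F] {ℓ : H1 Ω →L[ℝ] F} (hℓ : ∀ v ∈ testH1 Ω, ℓ v = 0) (hv : v ∈ H10 Ω) : ℓ v = 0 :=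
  (testH1 Ω).topologicalClosure_minimal (t := ℓ.ker) hℓ ℓ.isClosed_ker hv

end BoundaryValue

section BoundaryDecomposition

variable {Ω : Opens E3} {L : ℕ} {Γ : Fin (L + 1) → Set E3}

theorem IsBoundaryDecomposition.mem_H10 (hΓ : IsBoundaryDecomposition (Ω : Set E3) L Γ)
    (hbdd : Bornology.IsBounded (Ω : Set E3)) {v : H1 Ω}
    (hv : ∀ i, HasBoundaryValue v (Γ i) 0) : v ∈ H10 Ω := by
  refine HasBoundaryValue.mem_H10 hbdd ?_
  simpa [← hΓ.iUnion_eq] using HasBoundaryValue.biUnion hbdd Finset.univ_nonempty hΓ.isClosed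
    (fun i j hij => hΓ.disjoint i j hij) hv

theorem IsBoundaryDecomposition.exists_contDiff_cutoff
    (hΓ : IsBoundaryDecomposition (Ω : Set E3) L Γ) (i : Fin (L + 1)) :
    ∃ ζ : E3 → ℝ, ContDiff ℝ ∞ ζ ∧
      ∀ j, ∀ y ∈ Γ j, ∀ᶠ x in 𝓝 y, ζ x = if j = i then 1 else 0 := by
  obtain ⟨ζ, hζ, h0, h1⟩ := exists_contDiff_separation
    ((Set.toFinite {j | j ≠ i}).isClosed_biUnion fun j _ => hΓ.isClosed j) (hΓ.isClosed i)
    (Set.disjoint_iUnion₂_left.2 fun j hj => hΓ.disjoint j i hj)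
  refine ⟨ζ, hζ, fun j y hy => ?_⟩
  by_cases hj : j = i
  · subst hj
    simpa using h1 y hy
  · simpa [hj] using h0 y (Set.mem_biUnion hj hy)

/-- `χ i`, for `i = 1, …, L`, has boundary value `1` on `Γ i` and `0` on the other components of the
boundary; these functions span `H¹_{0c}(Ω)` modulo `H¹₀(Ω)`. -/
def IsBoundaryIndicator (Γ : Fin (L + 1) → Set E3) (χ : Fin L → H1 Ω) : Prop :=
  ∀ i j, HasBoundaryValue (χ i) (Γ j) (if j = i.succ then 1 else 0)

theorem MemH10c.exists_add_sum_mem_H10 {s : H1 Ω} (hs : MemH10c Γ s)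
    (hΓ : IsBoundaryDecomposition (Ω : Set E3) L Γ) (hbdd : Bornology.IsBounded (Ω : Set E3))
    {χ : Fin L → H1 Ω} (hχ : IsBoundaryIndicator Γ χ) :
    ∃ α : Fin L → ℝ, s + ∑ i, α i • χ i ∈ H10 Ω := by
  choose α hα using hs.2
  refine ⟨fun i => -α i, hΓ.mem_H10 hbdd fun j => ?_⟩
  have hsum : HasBoundaryValue (∑ i, (-α i) • χ i) (Γ j)
      (∑ i, (-α i) * if j = i.succ then 1 else 0) :=
    HasBoundaryValue.sum _ fun i _ => (hχ i j).smul _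
  induction j using Fin.cases with
  | zero => simpa [(Fin.succ_ne_zero _).symm] using hs.1.add hsum
  | succ k => simpa using (hα k).add hsum

theorem MemH10c.apply_eq_zero {s : H1 Ω} (hs : MemH10c Γ s)
    (hΓ : IsBoundaryDecomposition (Ω : Set E3) L Γ) (hbdd : Bornology.IsBounded (Ω : Set E3))
    {χ : Fin L → H1 Ω} (hχ : IsBoundaryIndicator Γ χ) {ℓ : H1 Ω →L[ℝ] ℝ}
    (hℓ : ∀ v ∈ testH1 Ω, ℓ v = 0) (hℓχ : ∀ i, ℓ (χ i) = 0) : ℓ s = 0 := by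
  obtain ⟨α, hα⟩ := hs.exists_add_sum_mem_H10 hΓ hbdd hχ
  simpa [hℓχ] using apply_eq_zero_of_mem_H10 hℓ hα

theorem IsBoundaryDecomposition.exists_isBoundaryIndicator
    (hΓ : IsBoundaryDecomposition (Ω : Set E3) L Γ) (hbdd : Bornology.IsBounded (Ω : Set E3)) :
    ∃ χ : Fin L → H1 Ω, IsBoundaryIndicator Γ χ ∧ ∀ i, ∃ ζ : E3 → ℝ, ContDiff ℝ ∞ ζ ∧
      (∀ y ∈ frontier (Ω : Set E3), ∀ᶠ x in 𝓝 y, gradient ζ x = 0) ∧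
        toL2 (χ i) =ᵐ[volume.restrict (Ω : Set E3)] ζ := by
  choose ζ hζ hζΓ using fun i : Fin L => hΓ.exists_contDiff_cutoff i.succ
  choose χ hχ using fun i => exists_H1_of_contDiff hbdd ((hζ i).of_le (by simp))
  refine ⟨χ, fun i j => subset_closure ⟨ζ i, (hζ i).contDiffOn, hχ i, fun y hy => ?_⟩,
    fun i => ⟨ζ i, hζ i, fun y hy => ?_, hχ i⟩⟩
  · exact (tendsto_const_nhds.congr' ((hζΓ i j y hy).mono fun x hx => hx.symm)).mono_left
      nhdsWithin_le_nhds
  · rw [← hΓ.iUnion_eq, Set.mem_iUnion] at hy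
    obtain ⟨j, hj⟩ := hy
    filter_upwards [(hζΓ i j y hj).eventually_nhds] with x hx
    rw [EventuallyEq.gradient_eq hx, gradient_fun_const]

end BoundaryDecomposition

/-! ### Curls -/

section Curl

theorem curlOfGradients_apply (J : Fin 3 → E3) (k : Fin 3) :
    curlOfGradients J k = J (k + 2) (k + 1) - J (k + 1) (k + 2) := by
  fin_cases k <;> rfl

theorem memLp_curlOfGradients {μ : Measure E3} {p : ℝ≥0∞} {J : Fin 3 → E3 → E3}
    (hJ : ∀ i, MemLp (J i) p μ) : MemLp (fun x => curlOfGradients fun i => J i x) p μ :=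
  MemLp.of_eval_piLp fun k => by
    simp only [curlOfGradients_apply]
    exact ((hJ _).eval_piLp _).sub ((hJ _).eval_piLp _)

theorem curl_gradient {ζ : E3 → ℝ} {x : E3} (hζ : ContDiffAt ℝ 2 ζ x) :
    curl (gradient ζ) x = 0 := by
  have hd : DifferentiableAt ℝ (fderiv ℝ ζ) x :=
    (hζ.fderiv_right (m := 1) (by norm_num)).differentiableAt one_ne_zero
  have hsecond (i k : Fin 3) : gradient (fun y => gradient ζ y i) x k
      = fderiv ℝ (fderiv ℝ ζ) x (EuclideanSpace.single k 1) (EuclideanSpace.single i 1) := by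
    simp only [gradient_apply]
    rw [fderiv_clm_apply hd (differentiableAt_const _)]
    simp
  ext k
  rw [curl, curlOfGradients_apply, hsecond, hsecond,
    hζ.isSymmSndFDerivAt (by simp) (EuclideanSpace.single (k + 1) 1), sub_self, PiLp.zero_apply]

theorem curl_eqOn {Ω : Opens E3} {a b : E3 → E3} (h : Set.EqOn a b Ω) :
    Set.EqOn (curl a) (curl b) Ω := fun x hx => by
  have hi (i : Fin 3) : gradient (fun y => a y i) x = gradient (fun y => b y i) x :=
    gradient_eqOn (fun y hy => congrArg (· i) (h hy)) hx
  simp only [curl, hi]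

theorem integral_inner_curlOfGradients {μ : Measure E3} {a : E3 → E3} {J : Fin 3 → E3 → E3}
    (h : ∀ k i j, Integrable (fun x => a x k * J i x j) μ) :
    ∫ x, inner ℝ (a x) (curlOfGradients fun i => J i x) ∂μ
      = ∑ k, ((∫ x, a x k * J (k + 2) x (k + 1) ∂μ) - ∫ x, a x k * J (k + 1) x (k + 2) ∂μ) := by
  have hpt (x : E3) : inner ℝ (a x) (curlOfGradients fun i => J i x)
      = ∑ k, (a x k * J (k + 2) x (k + 1) - a x k * J (k + 1) x (k + 2)) := by
    simp only [PiLp.inner_apply, curlOfGradients_apply, RCLike.inner_apply, conj_trivial, ← mul_sub,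
      mul_comm]
  simp only [hpt]
  refine (integral_finsetSum Finset.univ fun k _ =>
    (h k (k + 2) (k + 1)).sub (h k (k + 1) (k + 2))).trans ?_
  exact Finset.sum_congr rfl fun k _ => integral_sub (h k (k + 2) (k + 1)) (h k (k + 1) (k + 2))

end Curl

section TestField

variable {Ω : Opens E3}

/-- The `i`-th component of a test field, as a test function. -/
noncomputable def testComponent (w : 𝓓(Ω, E3)) (i : Fin 3) : 𝓓(Ω, ℝ) :=
  TestFunction.postcompCLM (𝕜 := ℝ) (EuclideanSpace.proj (𝕜 := ℝ) i) w

theorem coe_testComponent (w : 𝓓(Ω, E3)) (i : Fin 3) :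
    ⇑(testComponent w i) = fun x => w x i :=
  rfl

theorem setIntegral_toL2_mul_gradient_apply (v : H1 Ω) (η : 𝓓(Ω, ℝ)) (k : Fin 3) :
    ∫ x in (Ω : Set E3), toL2 v x * gradient η x k
      = - ∫ x in (Ω : Set E3), η x * grad v x k := by
  have h := congrArg (EuclideanSpace.proj (𝕜 := ℝ) k) (setIntegral_toL2_smul_gradient v η)
  rw [map_neg, ← ContinuousLinearMap.integral_comp_comm _
      (integrable_smul_of_memLp (Lp.memLp _) (memLp_gradient_test η)),
    ← ContinuousLinearMap.integral_comp_comm _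
      (integrable_smul_of_memLp (memLp_test η) (Lp.memLp _))] at h
  simpa only [PiLp.proj_apply, PiLp.smul_apply, smul_eq_mul] using h

theorem memLp_curl_testFunction (w : 𝓓(Ω, E3)) :
    MemLp (curl w) 2 (volume.restrict (Ω : Set E3)) :=
  memLp_curlOfGradients fun i => memLp_gradient_test (testComponent w i)

theorem setIntegral_inner_testFunction_curl (w : 𝓓(Ω, E3)) (v : Fin 3 → H1 Ω) :
    ∫ x in (Ω : Set E3), inner ℝ (w x) (curlOfGradients fun i => grad (v i) x)
      = ∫ x in (Ω : Set E3), inner ℝ (curl w x) (WithLp.toLp 2 fun i => toL2 (v i) x) := by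
  have hgrad (k i j : Fin 3) : Integrable (fun x => w x k * grad (v i) x j)
      (volume.restrict (Ω : Set E3)) :=
    (integrable_smul_of_memLp (memLp_test (testComponent w k)) (Lp.memLp _)).eval_piLp j
  have htest (k i j : Fin 3) :
      Integrable (fun x => toL2 (v k) x * gradient (fun y => w y i) x j)
        (volume.restrict (Ω : Set E3)) :=
    (integrable_smul_of_memLp (Lp.memLp _) (memLp_gradient_test (testComponent w i))).eval_piLp j
  have hparts (k i j : Fin 3) := setIntegral_toL2_mul_gradient_apply (v k) (testComponent w i) j
  simp only [coe_testComponent] at hparts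
  simp_rw [real_inner_comm _ (curl w _), curl]
  rw [integral_inner_curlOfGradients hgrad, integral_inner_curlOfGradients htest]
  simp only [hparts, Fin.sum_univ_three]
  simp only [Fin.reduceAdd]
  ring

theorem memH0Curl_of_green {v c : L2Vec Ω}
    (h : ∀ w : Fin 3 → H1 Ω,
      ∫ x in (Ω : Set E3), inner ℝ (v x) (curlOfGradients fun i => grad (w i) x)
        = ∫ x in (Ω : Set E3), inner ℝ (c x) (WithLp.toLp 2 fun i => toL2 (w i) x)) :
    MemH0Curl v c := by
  refine ⟨fun w => ?_, h⟩
  choose W hW hW_grad using fun i => exists_H1_of_testFunction (testComponent w i)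
  refine (integral_congr_ae ?_).trans ((h W).trans (integral_congr_ae ?_))
  · filter_upwards [ae_all_iff.2 hW_grad] with x hx
    simp only [hx]
    rfl
  · filter_upwards [ae_all_iff.2 hW] with x hx
    simp only [hx]
    rfl

theorem memH0Curl_of_ae_eq_testFunction {v c : L2Vec Ω} (w : 𝓓(Ω, E3))
    (hv : v =ᵐ[volume.restrict (Ω : Set E3)] w)
    (hc : c =ᵐ[volume.restrict (Ω : Set E3)] curl w) : MemH0Curl v c := by
  refine memH0Curl_of_green fun z => ?_
  refine (integral_congr_ae ?_).trans
    ((setIntegral_inner_testFunction_curl w z).trans (integral_congr_ae ?_))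
  · filter_upwards [hv] with x hx
    rw [hx]
  · filter_upwards [hc] with x hx
    rw [hx]

theorem exists_memH0Curl_testFunction (w : 𝓓(Ω, E3)) :
    ∃ ψ c : L2Vec Ω, MemH0Curl ψ c ∧ ψ =ᵐ[volume.restrict (Ω : Set E3)] w ∧
      c =ᵐ[volume.restrict (Ω : Set E3)] curl w := by
  have hw : MemLp w 2 (volume.restrict (Ω : Set E3)) :=
    (w.continuous.memLp_of_hasCompactSupport w.hasCompactSupport).restrict _
  have hc := memLp_curl_testFunction w
  exact ⟨hw.toLp w, hc.toLp _, memH0Curl_of_ae_eq_testFunction w hw.coeFn_toLp hc.coeFn_toLp,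
    hw.coeFn_toLp, hc.coeFn_toLp⟩

theorem memH0Curl_zero_of_ae_eq_testFunction_of_eqOn_gradient {v : L2Vec Ω} {w : 𝓓(Ω, E3)}
    {ζ : E3 → ℝ} (hv : v =ᵐ[volume.restrict (Ω : Set E3)] w) (hζ : ContDiff ℝ ∞ ζ)
    (hw : Set.EqOn w (gradient ζ) Ω) : MemH0Curl v 0 := by
  refine memH0Curl_of_ae_eq_testFunction w hv ?_
  filter_upwards [Lp.coeFn_zero E3 2 (volume.restrict (Ω : Set E3)),
    ae_restrict_mem Ω.isOpen.measurableSet] with x h0 hx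
  rw [h0, curl_eqOn hw hx, curl_gradient (hζ.contDiffAt.of_le (WithTop.coe_le_coe.2 le_top)),
    Pi.zero_apply]

theorem memH0Curl_grad_of_mem_testH1 {v : H1 Ω} (hv : v ∈ testH1 Ω) : MemH0Curl (grad v) 0 := by
  obtain ⟨η, hη⟩ := hv
  exact memH0Curl_zero_of_ae_eq_testFunction_of_eqOn_gradient (w := testGradient η)
    (grad_ae_eq_gradient (η.contDiff.of_le (by simp)).contDiffOn hη) η.contDiff fun _ _ => rfl

theorem memH0Curl_grad_of_gradient_eventually_eq_zero (hbdd : Bornology.IsBounded (Ω : Set E3))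
    {v : H1 Ω} {ζ : E3 → ℝ} (hζ : ContDiff ℝ ∞ ζ)
    (h0 : ∀ y ∈ frontier (Ω : Set E3), ∀ᶠ x in 𝓝 y, gradient ζ x = 0)
    (hv : toL2 v =ᵐ[volume.restrict (Ω : Set E3)] ζ) : MemH0Curl (grad v) 0 := by
  have hgrad : ContDiff ℝ ∞ (gradient ζ) :=
    isBoundedLinearMap_toDual_symm.contDiff.comp (hζ.fderiv_right (by simp))
  obtain ⟨w, hw⟩ := exists_testFunction_eqOn hbdd hgrad.contDiffOn fun y hy =>
    (h0 y hy).filter_mono nhdsWithin_le_nhds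
  refine memH0Curl_zero_of_ae_eq_testFunction_of_eqOn_gradient (w := w) ?_ hζ hw
  filter_upwards [grad_ae_eq_gradient (hζ.of_le (by simp)).contDiffOn hv,
    ae_restrict_mem Ω.isOpen.measurableSet] with x hx hxΩ
  rw [hx, hw hxΩ]

theorem setIntegral_inner_zero_left (b : E3 → E3) :
    ∫ x in (Ω : Set E3), inner ℝ ((0 : L2Vec Ω) x) (b x) = 0 := by
  refine integral_eq_zero_of_ae ?_
  filter_upwards [Lp.coeFn_zero E3 2 (volume.restrict (Ω : Set E3))] with x hx
  rw [hx, Pi.zero_apply, inner_zero_left, Pi.zero_apply]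

theorem setIntegral_inner_zero_right (a : E3 → E3) :
    ∫ x in (Ω : Set E3), inner ℝ (a x) ((0 : L2Vec Ω) x) = 0 := by
  simpa only [real_inner_comm] using setIntegral_inner_zero_left a

theorem memH0Curl_grad_of_memH10c {L : ℕ} {Γ : Fin (L + 1) → Set E3} {s : H1 Ω}
    (hs : MemH10c Γ s) (hΓ : IsBoundaryDecomposition (Ω : Set E3) L Γ)
    (hbdd : Bornology.IsBounded (Ω : Set E3)) : MemH0Curl (grad s) 0 := by
  obtain ⟨χ, hχ, hχ_smooth⟩ := hΓ.exists_isBoundaryIndicator hbdd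
  refine memH0Curl_of_green fun w => ?_
  have hK : MemLp (fun x => curlOfGradients fun i => grad (w i) x) 2
      (volume.restrict (Ω : Set E3)) := memLp_curlOfGradients fun i => Lp.memLp (grad (w i))
  let ℓ : H1 Ω →L[ℝ] ℝ := innerSL ℝ (hK.toLp _) ∘L gradL Ω
  have hℓ (v : H1 Ω) : ∫ x in (Ω : Set E3),
      inner ℝ (grad v x) (curlOfGradients fun i => grad (w i) x) = ℓ v := by
    change _ = inner ℝ (hK.toLp _) (grad v)
    rw [real_inner_comm, L2.inner_def]
    refine integral_congr_ae ?_
    filter_upwards [hK.coeFn_toLp] with x hx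
    rw [hx]
  have hℓ_zero (v : H1 Ω) (hv : MemH0Curl (grad v) 0) : ℓ v = 0 := by
    rw [← hℓ, hv.2 w, setIntegral_inner_zero_left]
  rw [hℓ, setIntegral_inner_zero_left]
  refine hs.apply_eq_zero hΓ hbdd hχ (fun v hv => hℓ_zero v (memH0Curl_grad_of_mem_testH1 hv))
    fun i => ?_
  obtain ⟨ζ, hζ, h0, hχζ⟩ := hχ_smooth i
  exact hℓ_zero _ (memH0Curl_grad_of_gradient_eventually_eq_zero hbdd hζ h0 hχζ)

end TestField

/-! ### Functions with vanishing weak gradient -/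

theorem exists_ae_eq_const_of_locally_ae_eq_const {X β : Type*} [TopologicalSpace X]
    [SecondCountableTopology X] [MeasurableSpace X] {μ : Measure X} [μ.IsOpenPosMeasure]
    {U : Set X} (hU : IsConnected U) {F : X → β}
    (h : ∀ y ∈ U, ∃ (c : β) (V : Set X), IsOpen V ∧ y ∈ V ∧ ∀ᵐ x ∂μ, x ∈ V → F x = c) :
    ∃ c : β, ∀ᵐ x ∂μ, x ∈ U → F x = c := by
  obtain ⟨x₀, hx₀⟩ := hU.nonempty
  have : Nonempty β := ⟨F x₀⟩
  choose! c V hV hyV hc using h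
  have hc_local {x y : X} (hx : x ∈ U) (hy : y ∈ U) (hyx : y ∈ V x) : c x = c y := by
    have hpos : μ (V x ∩ V y) ≠ 0 :=
      (((hV x hx).inter (hV y hy)).measure_pos μ ⟨y, hyx, hyV y hy⟩).ne'
    obtain ⟨z, ⟨hzx, hzy⟩, hcx, hcy⟩ :=
      ((frequently_ae_mem_iff.2 hpos).and_eventually ((hc x hx).and (hc y hy))).exists
    exact (hcx hzx).symm.trans (hcy hzy)
  have hc_const {x : X} (hx : x ∈ U) : c x = c x₀ := by
    refine hU.isPreconnected.induction₂ (fun x y => c x = c y) (fun x hx => ?_)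
      (fun _ _ _ _ _ _ => Eq.trans) (fun _ _ _ _ => Eq.symm) hx hx₀
    filter_upwards [inter_mem_nhdsWithin U ((hV x hx).mem_nhds (hyV x hx))] with y hy
    exact hc_local hx hy.1 hy.2
  refine ⟨c x₀, ae_iff.2 (measure_null_of_locally_null _ fun y hy => ?_)⟩
  simp only [Set.mem_ofPred_eq, Classical.not_imp] at hy
  refine ⟨_, inter_mem_nhdsWithin _ ((hV y hy.1).mem_nhds (hyV y hy.1)),
    measure_mono_null (fun x hx => ?_) (ae_iff.1 (hc y hy.1))⟩
  simp only [Set.mem_inter_iff, Set.mem_ofPred_eq, Classical.not_imp] at hx ⊢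
  exact ⟨hx.2, hc_const hy.1 ▸ hx.1.2⟩

section WeakGradient

open scoped Convolution

variable {E : Type*} [NormedAddCommGroup E] [InnerProductSpace ℝ E] [FiniteDimensional ℝ E]
  [MeasurableSpace E] [BorelSpace E] {μ : Measure E} [μ.IsAddHaarMeasure] {U : Opens E}
  {F : E → ℝ}

theorem hasFDerivAt_convolution_zero_of_weakGradient_eq_zero (hF : LocallyIntegrable F μ)
    (h : ∀ η : 𝓓(U, ℝ), ∫ x, F x • gradient η x ∂μ = 0) {g : E → ℝ} (hg : ContDiff ℝ ∞ g)
    (hgc : HasCompactSupport g) {x : E} (hx : ∀ z, x - z ∈ tsupport g → z ∈ U) :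
    HasFDerivAt (g ⋆[ContinuousLinearMap.lsmul ℝ ℝ, μ] F) (0 : E →L[ℝ] ℝ) x := by
  let η : 𝓓(U, ℝ) :=
    { toFun := fun z => g (x - z)
      contDiff' := hg.comp (contDiff_const.sub contDiff_id)
      hasCompactSupport' := hgc.comp_homeomorph (Homeomorph.subLeft x)
      tsupport_subset' := fun z hz => hx z
        (tsupport_comp_subset_preimage g (f := fun z => x - z) (by fun_prop) hz) }
  have hη (z : E) : fderiv ℝ η z = -fderiv ℝ g (x - z) := by
    have hcomp : HasFDerivAt η (fderiv ℝ g (x - z) ∘L (-ContinuousLinearMap.id ℝ E)) z :=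
      (hg.differentiable (by simp) (x - z)).hasFDerivAt.comp z ((hasFDerivAt_id z).const_sub x)
    rw [hcomp.fderiv]
    ext v
    simp
  have hint : ∫ z, F z • fderiv ℝ η z ∂μ = 0 := by
    have hi : Integrable (fun z => F z • gradient η z) μ := by
      simpa using (testGradient η).integrable_bilin (ContinuousLinearMap.lsmul ℝ ℝ).flip
        (hF.locallyIntegrableOn _)
    have hdual (z : E) : innerSL ℝ (F z • gradient η z) = F z • fderiv ℝ η z := by
      ext v
      simp [inner_gradient_left]
    simpa [hdual, h η] using ContinuousLinearMap.integral_comp_comm (innerSL ℝ) hi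
  refine (hgc.hasFDerivAt_convolution_left (ContinuousLinearMap.lsmul ℝ ℝ)
    (hg.of_le (by simp)) hF x).congr_fderiv ?_
  rw [convolution_eq_swap, ← neg_eq_zero, ← integral_neg, ← hint]
  congr 1 with z v
  simp [hη, mul_comm]

theorem exists_ae_eq_const_ball_of_weakGradient_eq_zero (hF : LocallyIntegrable F μ)
    (h : ∀ η : 𝓓(U, ℝ), ∫ x, F x • gradient η x ∂μ = 0) {y : E} {r : ℝ}
    (hr : 0 < r) (hyU : Metric.ball y (2 * r) ⊆ U) :
    ∃ c : ℝ, ∀ᵐ x ∂μ, x ∈ Metric.ball y r → F x = c := by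
  let φ (n : ℕ) : ContDiffBump (0 : E) :=
    ⟨r / (n + 1) / 2, r / (n + 1), by positivity, half_lt_self (by positivity)⟩
  let f (n : ℕ) : E → ℝ := (φ n).normed μ ⋆[ContinuousLinearMap.lsmul ℝ ℝ, μ] F
  have hf_lim : ∀ᵐ x ∂μ, Tendsto (fun n => f n x) atTop (𝓝 (F x)) := by
    refine ContDiffBump.ae_convolution_tendsto_right_of_locallyIntegrable (K := 2)
      (tendsto_const_nhds.div_atTop
        (tendsto_atTop_add_const_right _ _ tendsto_natCast_atTop_atTop))
      (.of_forall fun n => ?_) hF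
    exact (mul_div_cancel₀ (r / (n + 1)) two_ne_zero).ge
  have hf_deriv (n : ℕ) (x : E) (hx : x ∈ Metric.ball y r) :
      HasFDerivAt (f n) (0 : E →L[ℝ] ℝ) x := by
    refine hasFDerivAt_convolution_zero_of_weakGradient_eq_zero hF h (φ n).contDiff_normed
      (φ n).hasCompactSupport_normed fun z hz => hyU ?_
    rw [(φ n).tsupport_normed_eq, mem_closedBall_zero_iff, ← dist_eq_norm, dist_comm] at hz
    have hzx : dist z x ≤ r := hz.trans (div_le_self hr.le (by simp))
    rw [Metric.mem_ball] at hx ⊢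
    linarith [dist_triangle z x y]
  have hf_const (n : ℕ) (x : E) (hx : x ∈ Metric.ball y r) : f n x = f n y :=
    Metric.isOpen_ball.is_const_of_fderiv_eq_zero (𝕜 := ℝ) (convex_ball y r).isPreconnected
      (fun z hz => (hf_deriv n z hz).differentiableAt.differentiableWithinAt)
      (fun z hz => (hf_deriv n z hz).fderiv) hx (Metric.mem_ball_self hr)
  refine ⟨limUnder atTop fun n => f n y, ?_⟩
  filter_upwards [hf_lim] with x hx hxy
  exact (Tendsto.limUnder_eq (hx.congr fun n => hf_const n x hxy)).symm

theorem exists_ae_eq_const_of_weakGradient_eq_zero (hU : IsConnected (U : Set E))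
    (hF : LocallyIntegrable F μ) (h : ∀ η : 𝓓(U, ℝ), ∫ x, F x • gradient η x ∂μ = 0) :
    ∃ c : ℝ, ∀ᵐ x ∂μ, x ∈ (U : Set E) → F x = c := by
  refine exists_ae_eq_const_of_locally_ae_eq_const hU fun y hy => ?_
  obtain ⟨r, hr, hrU⟩ := Metric.isOpen_iff.1 U.isOpen y hy
  obtain ⟨c, hc⟩ := exists_ae_eq_const_ball_of_weakGradient_eq_zero hF h (half_pos hr)
    (y := y) (by rwa [mul_div_cancel₀ r two_ne_zero])
  exact ⟨c, _, Metric.isOpen_ball, Metric.mem_ball_self (half_pos hr), hc⟩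

end WeakGradient

/-! ### Uniqueness -/

section Exterior

variable {Ω : Set E3}

theorem exteriorRegion_subset_compl : exteriorRegion Ω ⊆ (closure Ω)ᶜ := fun _ hx => hx.1

theorem exteriorRegion_nonempty (hΩ : Bornology.IsBounded Ω) : (exteriorRegion Ω).Nonempty := by
  obtain ⟨R, hR⟩ := hΩ.closure.subset_closedBall 0
  obtain ⟨e, he⟩ : ∃ e : E3, ‖e‖ = 1 := exists_norm_eq E3 zero_le_one
  have hnorm {t : ℝ} (ht : t ∈ Set.Ioi |R|) : ‖t • e‖ = t := by
    rw [norm_smul, he, mul_one, Real.norm_of_nonneg ((abs_nonneg R).trans ht.le)]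
  have hray : (fun t : ℝ => t • e) '' Set.Ioi |R| ⊆ (closure Ω)ᶜ := by
    rintro _ ⟨t, ht, rfl⟩ hΩt
    have := mem_closedBall_zero_iff.1 (hR hΩt)
    exact (((le_abs_self R).trans_lt ht).trans_le (hnorm ht).ge).not_ge this
  have hstart : (|R| + 1) • e ∈ (fun t : ℝ => t • e) '' Set.Ioi |R| :=
    Set.mem_image_of_mem _ (Set.mem_Ioi.2 (lt_add_one _))
  have hcomponent := (isPreconnected_Ioi.image (fun t : ℝ => t • e)
    (by fun_prop)).subset_connectedComponentIn hstart hray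
  refine ⟨(|R| + 1) • e, hray hstart, fun hb => ?_⟩
  obtain ⟨C, hC⟩ := (hb.subset hcomponent).exists_norm_le
  have ht : |R| + |C| + 1 ∈ Set.Ioi |R| := by
    simp only [Set.mem_Ioi]
    linarith [abs_nonneg C]
  have hle := hC _ (Set.mem_image_of_mem _ ht)
  rw [hnorm ht] at hle
  linarith [le_abs_self C, abs_nonneg R]

theorem frontier_exteriorRegion_nonempty (hΩ : Bornology.IsBounded Ω) (hne : Ω.Nonempty) :
    (frontier (exteriorRegion Ω)).Nonempty := by
  obtain ⟨x, hx⟩ := hne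
  exact nonempty_frontier_iff.2 ⟨exteriorRegion_nonempty hΩ,
    (Set.ne_univ_iff_exists_notMem _).2
      ⟨x, fun h => exteriorRegion_subset_compl h (subset_closure hx)⟩⟩

end Exterior

section Uniqueness

variable {Ω : Opens E3} {v : H1 Ω} {S : Set E3}

theorem setIntegral_grad_eq_zero_of_mem_H10 (hbdd : Bornology.IsBounded (Ω : Set E3))
    (hv : v ∈ H10 Ω) : ∫ x in (Ω : Set E3), grad v x = 0 := by
  have hone : MemLp (fun _ : E3 => (1 : ℝ)) 2 (volume.restrict (Ω : Set E3)) :=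
    memLp_restrict_of_continuous hbdd continuous_const 2
  let ℓ : H1 Ω →L[ℝ] E3 :=
    (ContinuousLinearMap.lsmul ℝ ℝ).lpPairing _ 2 2 (hone.toLp _) ∘L gradL Ω
  have hℓ (w : H1 Ω) : ℓ w = ∫ x in (Ω : Set E3), grad w x := by
    simp only [ℓ, ContinuousLinearMap.comp_apply, gradL_apply,
      ContinuousLinearMap.lpPairing_eq_integral]
    refine integral_congr_ae (hone.coeFn_toLp.mono fun x hx => ?_)
    simp [hx]
  rw [← hℓ]
  refine apply_eq_zero_of_mem_H10 (fun w ⟨η, hη⟩ => ?_) hv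
  rw [hℓ, integral_congr_ae (grad_ae_eq_gradient (η.contDiff.of_le (by simp)).contDiffOn hη),
    setIntegral_gradient_testFunction]

theorem setIntegral_toL2_smul_gradient_eq_zero (hbdd : Bornology.IsBounded (Ω : Set E3))
    (hv : HasBoundaryValue v S 0) (hgrad : grad v =ᵐ[volume.restrict (Ω : Set E3)] 0)
    {h : E3 → ℝ} (hh : ContDiff ℝ ∞ h)
    (hS : ∀ y ∈ frontier (Ω : Set E3) \ S, ∀ᶠ x in 𝓝 y, h x = 0) :
    ∫ x in (Ω : Set E3), toL2 v x • gradient h x = 0 := by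
  obtain ⟨M, hM⟩ := exists_mulH1_of_contDiff hbdd hh
  have hloc : LocallyIntegrableOn (fun x => toL2 v x • gradient h x) Ω :=
    locallyIntegrableOn_of_memLp le_rfl ((memLp_restrict_of_continuous hbdd
      (continuous_gradient (hh.of_le (by simp))) 2).smul (Lp.memLp (toL2 v)))
  have hgradM : grad (M v) =ᵐ[volume.restrict (Ω : Set E3)] fun x => toL2 v x • gradient h x := by
    refine grad_ae_eq hloc fun η => ?_
    rw [integral_congr_ae ((hM v).mono fun x hx => by rw [hx]),
      setIntegral_mul_toL2_smul_gradient hh.contDiffOn]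
    congr 1
    exact integral_congr_ae (hgrad.mono fun x hx => by simp [hx])
  rw [← integral_congr_ae hgradM]
  exact setIntegral_grad_eq_zero_of_mem_H10 hbdd (mul_mem_H10 hbdd hh hM hS hv)

/- Multiplied by a test function of `Ω ∪ ball y r`, `v` lies in `H¹₀(Ω)`; hence its extension by `0`
has vanishing weak gradient on the connected set `Ω ∪ ball y r`, and is constant there. -/
theorem eq_zero_of_grad_ae_eq_zero (hbdd : Bornology.IsBounded (Ω : Set E3))
    (hconn : IsConnected (Ω : Set E3)) (hv : HasBoundaryValue v S 0)
    (hgrad : grad v =ᵐ[volume.restrict (Ω : Set E3)] 0) {y : E3} {r : ℝ}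
    (hinter : ((Ω : Set E3) ∩ Metric.ball y r).Nonempty)
    (hdiff : (Metric.ball y r \ closure (Ω : Set E3)).Nonempty)
    (hS : Metric.ball y r ∩ frontier (Ω : Set E3) ⊆ S) : v = 0 := by
  have hΩ : MeasurableSet (Ω : Set E3) := Ω.isOpen.measurableSet
  let U : Opens E3 := Ω ⊔ ⟨Metric.ball y r, Metric.isOpen_ball⟩
  have hU : IsConnected (U : Set E3) :=
    hconn.union hinter ⟨hinter.mono Set.inter_subset_right, (convex_ball y r).isPreconnected⟩
  let F : E3 → ℝ := (Ω : Set E3).indicator (toL2 v)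
  have hF : LocallyIntegrable F :=
    ((memLp_indicator_iff_restrict hΩ).2 (Lp.memLp (toL2 v))).locallyIntegrable one_le_two
  have hF_grad (η : 𝓓(U, ℝ)) : ∫ x, F x • gradient η x = 0 := by
    rw [← setIntegral_toL2_smul_gradient_eq_zero hbdd hv hgrad η.contDiff fun z hz => ?_,
      ← integral_indicator hΩ]
    · simp only [F, Set.indicator_smul_left]
    · refine notMem_tsupport_iff_eventuallyEq.1 fun h => ?_
      rcases η.tsupport_subset h with hzΩ | hzball
      · exact (Ω.isOpen.frontier_eq ▸ hz.1).2 hzΩ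
      · exact hz.2 (hS ⟨hzball, hz.1⟩)
  obtain ⟨c, hc⟩ := exists_ae_eq_const_of_weakGradient_eq_zero hU hF hF_grad
  have hc0 : c = 0 := by
    have hpos := ((Metric.isOpen_ball.sdiff isClosed_closure).measure_pos volume hdiff).ne'
    obtain ⟨x, ⟨hxball, hxΩ⟩, hx⟩ := ((frequently_ae_mem_iff.2 hpos).and_eventually hc).exists
    rw [← hx (Or.inr hxball)]
    exact Set.indicator_of_notMem (fun h => hxΩ (subset_closure h)) _
  refine H1.ext (Lp.ext ?_)
  filter_upwards [ae_restrict_of_ae hc, ae_restrict_mem hΩ,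
    Lp.coeFn_zero ℝ 2 (volume.restrict (Ω : Set E3))] with x hx hxΩ hx0
  have hFx : F x = toL2 v x := Set.indicator_of_mem hxΩ _
  exact (hFx.symm.trans ((hx (Or.inl hxΩ)).trans hc0)).trans hx0.symm

theorem IsBoundaryDecomposition.eq_zero_of_grad_ae_eq_zero {L : ℕ} {Γ : Fin (L + 1) → Set E3}
    (hΓ : IsBoundaryDecomposition (Ω : Set E3) L Γ) (hbdd : Bornology.IsBounded (Ω : Set E3))
    (hconn : IsConnected (Ω : Set E3)) (hv : HasBoundaryValue v (Γ 0) 0)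
    (hgrad : grad v =ᵐ[volume.restrict (Ω : Set E3)] 0) : v = 0 := by
  obtain ⟨y, hy⟩ := frontier_exteriorRegion_nonempty hbdd hconn.nonempty
  have hyΓ : y ∈ Γ 0 := hΓ.exterior hy
  have hyΩ : y ∈ closure (Ω : Set E3) :=
    frontier_subset_closure (hΓ.iUnion_eq ▸ Set.mem_iUnion_of_mem 0 hyΓ)
  have hclosed : IsClosed (⋃ i : Fin L, Γ i.succ) :=
    isClosed_iUnion_of_finite fun i => hΓ.isClosed i.succ
  have hyclosed : y ∉ ⋃ i : Fin L, Γ i.succ := fun h => by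
    obtain ⟨i, hi⟩ := Set.mem_iUnion.1 h
    exact Set.disjoint_left.1 (hΓ.disjoint 0 i.succ (Fin.succ_ne_zero i).symm) hyΓ hi
  obtain ⟨r, hr, hball⟩ := Metric.isOpen_iff.1 hclosed.isOpen_compl y hyclosed
  refine DivCurl.eq_zero_of_grad_ae_eq_zero hbdd hconn hv hgrad (y := y) (r := r) ?_ ?_ ?_
  · rw [Set.inter_comm]
    exact mem_closure_iff.1 hyΩ _ Metric.isOpen_ball (Metric.mem_ball_self hr)
  · obtain ⟨z, hzball, hz⟩ := mem_closure_iff.1 (frontier_subset_closure hy) _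
      Metric.isOpen_ball (Metric.mem_ball_self hr)
    exact ⟨z, hzball, exteriorRegion_subset_compl hz⟩
  · rintro z ⟨hzball, hz⟩
    rw [← hΓ.iUnion_eq] at hz
    obtain ⟨j, hj⟩ := Set.mem_iUnion.1 hz
    cases j using Fin.cases with
    | zero => exact hj
    | succ i => exact absurd (Set.mem_iUnion_of_mem i hj) (hball hzball)

end Uniqueness

/-! ### Coefficient matrices -/

theorem inner_toEuclideanLin_of_isSymm {n : Type*} [Fintype n] [DecidableEq n] {A : Matrix n n ℝ}
    (hA : A.IsSymm) (v w : EuclideanSpace ℝ n) :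
    inner ℝ (Matrix.toEuclideanLin A v) w = inner ℝ v (Matrix.toEuclideanLin A w) :=
  Matrix.isSymmetric_toEuclideanLin_iff.2
    ((Matrix.conjTranspose_eq_transpose_of_trivial A).trans hA) v w

section Coefficient

variable {Ω : Opens E3} {ε : E3 → Matrix (Fin 3) (Fin 3) ℝ}

theorem IsCoefficient.memLp (hε : IsCoefficient Ω ε) {v : E3 → E3} {p : ℝ≥0∞}
    (hv : MemLp v p (volume.restrict (Ω : Set E3))) :
    MemLp (fun x => Matrix.toEuclideanLin (ε x) (v x)) p (volume.restrict (Ω : Set E3)) := by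
  refine MemLp.of_eval_piLp fun i => ?_
  have hmul (j : Fin 3) : MemLp (fun x => ε x i j * v x j) p (volume.restrict (Ω : Set E3)) :=
    (hv.eval_piLp j).mul (hε.memLp_top i j)
  simpa [Matrix.toLpLin_apply, Matrix.mulVec, dotProduct] using
    memLp_finsetSum Finset.univ fun j _ => hmul j

theorem IsCoefficient.ae_eq_zero_of_energy_eq_zero (hε : IsCoefficient Ω ε) {v : E3 → E3}
    (hv : MemLp v 2 (volume.restrict (Ω : Set E3)))
    (h : ∫ x in (Ω : Set E3), inner ℝ (v x) (Matrix.toEuclideanLin (ε x) (v x)) = 0) :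
    v =ᵐ[volume.restrict (Ω : Set E3)] 0 := by
  obtain ⟨c, hc, hcoercive⟩ := hε.uniformlyPosDef
  have hnonneg : ∀ᵐ x ∂volume.restrict (Ω : Set E3),
      0 ≤ inner ℝ (v x) (Matrix.toEuclideanLin (ε x) (v x)) :=
    hcoercive.mono fun x hx => (by positivity : 0 ≤ c * ‖v x‖ ^ 2).trans (hx (v x))
  have hint : Integrable (fun x => inner ℝ (v x) (Matrix.toEuclideanLin (ε x) (v x)))
      (volume.restrict (Ω : Set E3)) :=
    memLp_one_iff_integrable.1 ((innerSL ℝ).memLp_of_bilin 1 hv (hε.memLp hv))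
  have henergy := (integral_eq_zero_iff_of_nonneg_ae hnonneg hint).1 h
  filter_upwards [henergy, hcoercive] with x hx hxc
  have hnorm : c * ‖v x‖ ^ 2 ≤ 0 := (hxc (v x)).trans hx.le
  simpa using nonpos_of_mul_nonpos_right hnorm hc

end Coefficient

/-! ### The extended weak formulation -/

section WeakFormulation

variable {Ω : Opens E3} {L : ℕ} {Γ : Fin (L + 1) → Set E3}

theorem setIntegral_inner_congr_right (a : E3 → E3) {b c : E3 → E3}
    (h : b =ᵐ[volume.restrict (Ω : Set E3)] c) :
    ∫ x in (Ω : Set E3), inner ℝ (a x) (b x) = ∫ x in (Ω : Set E3), inner ℝ (a x) (c x) :=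
  integral_congr_ae (h.mono fun x hx => by simp only [hx])

theorem toL2_zero_ae_eq : toL2 (0 : H1 Ω) =ᵐ[volume.restrict (Ω : Set E3)] 0 :=
  Lp.coeFn_zero ℝ 2 (volume.restrict (Ω : Set E3))

theorem grad_zero_ae_eq : grad (0 : H1 Ω) =ᵐ[volume.restrict (Ω : Set E3)] 0 :=
  Lp.coeFn_zero E3 2 (volume.restrict (Ω : Set E3))

theorem HasWeakDiv.setIntegral_inner_grad_eq_zero_of_mem_testH1 {g : E3 → E3}
    (hdiv : HasWeakDiv Ω g 0) {v : H1 Ω} (hv : v ∈ testH1 Ω) :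
    ∫ x in (Ω : Set E3), inner ℝ (g x) (grad v x) = 0 := by
  obtain ⟨η, hη⟩ := hv
  rw [setIntegral_inner_congr_right g
    (grad_ae_eq_gradient (η.contDiff.of_le (by simp)).contDiffOn hη), hdiv η]
  simp

theorem HasWeakDiv.setIntegral_inner_grad_eq_zero_of_memH10c {g : L2Vec Ω}
    (hdiv : HasWeakDiv Ω g 0) (hflux : ∀ i : Fin L, HasFlux Ω Γ g 0 i.succ 0)
    (hΓ : IsBoundaryDecomposition (Ω : Set E3) L Γ) (hbdd : Bornology.IsBounded (Ω : Set E3))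
    {s : H1 Ω} (hs : MemH10c Γ s) : ∫ x in (Ω : Set E3), inner ℝ (g x) (grad s x) = 0 := by
  choose χ hχ_one hχ_zero hχ_flux using hflux
  have hχ : IsBoundaryIndicator Γ χ := fun i j => by
    split_ifs with hj
    · exact hj ▸ hχ_one i
    · exact hχ_zero i j hj
  let ℓ : H1 Ω →L[ℝ] ℝ := innerSL ℝ g ∘L gradL Ω
  have hℓ (v : H1 Ω) : ℓ v = ∫ x in (Ω : Set E3), inner ℝ (g x) (grad v x) := L2.inner_def _ _
  rw [← hℓ]
  refine hs.apply_eq_zero hΓ hbdd hχ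
    (fun v hv => (hℓ v).trans (hdiv.setIntegral_inner_grad_eq_zero_of_mem_testH1 hv)) fun i => ?_
  simpa [hℓ, normalTrace] using hχ_flux i

theorem hasWeakDiv_of_normalTrace_eq_zero {v : E3 → E3} {d : E3 → ℝ}
    (h : ∀ φ ∈ testH1 Ω, normalTrace v d φ = 0) : HasWeakDiv Ω v d := fun η => by
  obtain ⟨φ, hφ, hφ_grad⟩ := exists_H1_of_testFunction η
  have hφ_mul : ∫ x in (Ω : Set E3), d x * toL2 φ x = ∫ x in (Ω : Set E3), d x * η x :=
    integral_congr_ae (hφ.mono fun x hx => by simp only [hx])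
  rw [← setIntegral_inner_congr_right v hφ_grad, ← hφ_mul]
  exact eq_neg_of_add_eq_zero_left (h φ ⟨η, hφ⟩)

namespace IsExtendedWeakSolution

variable {ε : E3 → Matrix (Fin 3) (Fin 3) ℝ} {f : E3 → ℝ} {g : L2Vec Ω} {φ₁ : DualTraceSpace Ω}
  {u : L2Vec Ω} {s : H1 Ω}

theorem normalTrace_eq (h : IsExtendedWeakSolution Γ ε f g φ₁ u s)
    (hε : ∀ᵐ x ∂volume.restrict (Ω : Set E3), (ε x).IsSymm) (φ : H1 Ω) :
    normalTrace (fun x => Matrix.toEuclideanLin (ε x) (u x)) f φ = φ₁ (trace Ω φ) := by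
  have hzero : MemH0Curl (0 : L2Vec Ω) 0 := memH0Curl_of_green fun w => by
    rw [setIntegral_inner_zero_left, setIntegral_inner_zero_left]
  have htest := h.2 φ 0 0 hzero
  have hflux : ∫ x in (Ω : Set E3),
      inner ℝ (u x) (Matrix.toEuclideanLin (ε x) (grad φ x) + (0 : L2Vec Ω) x)
        = ∫ x in (Ω : Set E3), inner ℝ (Matrix.toEuclideanLin (ε x) (u x)) (grad φ x) := by
    refine integral_congr_ae ?_
    filter_upwards [Lp.coeFn_zero E3 2 (volume.restrict (Ω : Set E3)), hε] with x hx hsymm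
    rw [hx, Pi.zero_apply, add_zero, inner_toEuclideanLin_of_isSymm hsymm]
  rw [bilinearForm, linearForm, hflux, setIntegral_inner_zero_left,
    setIntegral_inner_zero_right] at htest
  rw [normalTrace]
  linarith

theorem curl_equation (h : IsExtendedWeakSolution Γ ε f g φ₁ u s) {ψ c : L2Vec Ω}
    (hψ : MemH0Curl ψ c) :
    (∫ x in (Ω : Set E3), inner ℝ (u x) (c x))
        + ∫ x in (Ω : Set E3), inner ℝ (ψ x) (Matrix.toEuclideanLin (ε x) (grad s x))
      = ∫ x in (Ω : Set E3), inner ℝ (g x) (ψ x) := by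
  have htest := h.2 0 ψ c hψ
  have hgrad : ∫ x in (Ω : Set E3),
      inner ℝ (u x) (Matrix.toEuclideanLin (ε x) (grad (0 : H1 Ω) x) + c x)
        = ∫ x in (Ω : Set E3), inner ℝ (u x) (c x) :=
    setIntegral_inner_congr_right u (grad_zero_ae_eq.mono fun x hx => by simp [hx])
  have hf : ∫ x in (Ω : Set E3), f x * toL2 (0 : H1 Ω) x = 0 :=
    integral_eq_zero_of_ae (toL2_zero_ae_eq.mono fun x hx => by simp [hx])
  simpa [bilinearForm, linearForm, hgrad, hf] using htest

theorem eq_zero (h : IsExtendedWeakSolution Γ ε f g φ₁ u s) (hε : IsCoefficient Ω ε)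
    (hΓ : IsBoundaryDecomposition (Ω : Set E3) L Γ) (hbdd : Bornology.IsBounded (Ω : Set E3))
    (hconn : IsConnected (Ω : Set E3)) (hdiv : HasWeakDiv Ω g 0)
    (hflux : ∀ i : Fin L, HasFlux Ω Γ g 0 i.succ 0) : s = 0 := by
  have henergy := h.curl_equation (memH0Curl_grad_of_memH10c h.1 hΓ hbdd)
  rw [hdiv.setIntegral_inner_grad_eq_zero_of_memH10c hflux hΓ hbdd h.1,
    setIntegral_inner_zero_right, zero_add] at henergy
  exact hΓ.eq_zero_of_grad_ae_eq_zero hbdd hconn h.1.1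
    (hε.ae_eq_zero_of_energy_eq_zero (Lp.memLp _) henergy)

theorem hasWeakCurl (h : IsExtendedWeakSolution Γ ε f g φ₁ u 0) : HasWeakCurl Ω u g := fun w => by
  obtain ⟨ψ, c, hψc, hψ, hc⟩ := exists_memH0Curl_testFunction w
  have hzero : ∫ x in (Ω : Set E3),
      inner ℝ (ψ x) (Matrix.toEuclideanLin (ε x) (grad (0 : H1 Ω) x)) = 0 :=
    integral_eq_zero_of_ae (grad_zero_ae_eq.mono fun x hx => by simp [hx])
  rw [← setIntegral_inner_congr_right u hc, ← setIntegral_inner_congr_right g hψ,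
    ← h.curl_equation hψc, hzero, add_zero]

theorem hasWeakDiv (h : IsExtendedWeakSolution Γ ε f g φ₁ u s)
    (hε : ∀ᵐ x ∂volume.restrict (Ω : Set E3), (ε x).IsSymm) :
    HasWeakDiv Ω (fun x => Matrix.toEuclideanLin (ε x) (u x)) f :=
  hasWeakDiv_of_normalTrace_eq_zero fun φ hφ => by
    have htrace : trace Ω φ = 0 :=
      (Submodule.Quotient.mk_eq_zero _).2 ((testH1 Ω).le_topologicalClosure hφ)
    rw [h.normalTrace_eq hε, htrace, map_zero]

end IsExtendedWeakSolution

end WeakFormulation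

end DivCurl

theorem mainTheorem6_general (Ω : Opens E3)
    (hbdd : Bornology.IsBounded (Ω : Set E3)) (hconn : IsConnected (Ω : Set E3))
    (L : ℕ) (Γ : Fin (L + 1) → Set E3) (hΓ : IsBoundaryDecomposition (Ω : Set E3) L Γ)
    (ε : E3 → Matrix (Fin 3) (Fin 3) ℝ) (hε : IsCoefficient Ω ε)
    (f : E3 → ℝ) (_hf : ∀ φ : H1 Ω, IntegrableOn (fun x => f x * toL2 φ x) (Ω : Set E3))
    (g : L2Vec Ω) (hdiv : HasWeakDiv Ω g 0) (hflux : ∀ i : Fin L, HasFlux Ω Γ g 0 i.succ 0)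
    (φ₁ : DualTraceSpace Ω) (u : L2Vec Ω) (s : H1 Ω)
    (hus : IsExtendedWeakSolution Γ ε f g φ₁ u s) :
    HasWeakDiv Ω (fun x => Matrix.toEuclideanLin (ε x) (u x)) f ∧
    HasWeakCurl Ω u g ∧
    s = 0 ∧
    ∀ φ : H1 Ω,
      normalTrace (fun x => Matrix.toEuclideanLin (ε x) (u x)) f φ = φ₁ (trace Ω φ) := by
  have hs : s = 0 := hus.eq_zero hε hΓ hbdd hconn hdiv hflux
  have hcurl : HasWeakCurl Ω u g := (hs ▸ hus).hasWeakCurl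
  exact ⟨hus.hasWeakDiv hε.isSymm, hcurl, hs, hus.normalTrace_eq hε.isSymm⟩

/-- If `g` is divergence-free with zero flux through every inner boundary component, every solution
`(u, s)` of the extended weak formulation satisfies `∇·(εu) = f` and `∇×u = g` in `Ω`, `s = 0` in
`Ω`, and `εu·n = φ₁` in `H^{-1/2}(∂Ω)`. -/
theorem mainTheorem6 (Ω : TopologicalSpace.Opens E3)
    (hbdd : Bornology.IsBounded (Ω : Set E3)) (hconn : IsConnected (Ω : Set E3))
    (hpoly : IsPolyhedral (Ω : Set E3))
    (L : ℕ) (Γ : Fin (L + 1) → Set E3) (hΓ : IsBoundaryDecomposition (Ω : Set E3) L Γ)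
    (ε : E3 → Matrix (Fin 3) (Fin 3) ℝ) (hε : IsCoefficient Ω ε)
    (f : E3 → ℝ) (hf : MeasureTheory.IntegrableOn f (Ω : Set E3))
    (hf' : ∀ φ : H1 Ω, MeasureTheory.IntegrableOn (fun x => f x * toL2 φ x) (Ω : Set E3))
    (g : L2Vec Ω) (hdiv : HasWeakDiv Ω g 0) (hflux : ∀ i : Fin L, HasFlux Ω Γ g 0 i.succ 0)
    (φ₁ : DualTraceSpace Ω) (u : L2Vec Ω) (s : H1 Ω)
    (hus : IsExtendedWeakSolution Γ ε f g φ₁ u s) :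
    HasWeakDiv Ω (fun x => Matrix.toEuclideanLin (ε x) (u x)) f ∧
    HasWeakCurl Ω u g ∧
    s = 0 ∧
    ∀ φ : H1 Ω,
      normalTrace (fun x => Matrix.toEuclideanLin (ε x) (u x)) f φ = φ₁ (trace Ω φ) := by
  exact mainTheorem6_general Ω hbdd hconn L Γ hΓ ε hε f hf' g hdiv hflux φ₁ u s hus
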